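/- Let $q\in(0,1)$ and $c_1,c_2\in\mathbb C^\times$. Let $\mathcal U_q(\mathfrak{su}(3))$ be the unital associative complex algebra generated by $E_i,F_i,K_i^{\pm1}$ ($i=1,2$) subject to: the $K_i^{\pm1}$ commute, $K_iK_i^{-1}=1=K_i^{-1}K_i$, $K_iE_j=q^{a_{ij}}E_jK_i$, $K_iF_j=q^{-a_{ij}}F_jK_i$, $E_iF_j-F_jE_i=\delta_{ij}\frac{K_i-K_i^{-1}}{q-q^{-1}}$ (with $a_{ii}=2$ and $a_{ij}=-1$ for $i\ne j$), and, for $i\neq j$, $E_i^2E_j-(q+q^{-1})E_iE_jE_i+E_jE_i^2=0=F_i^2F_j-(q+q^{-1})F_iF_jF_i+F_jF_i^2$. Let $\mathcal B$ be the unital subalgebra of $\mathcal U_q(\mathfrak{su}(3))$ generated by $$K^{\pm1}=(K_1K_2^{-1})^{\pm1},\qquad B_1=F_1-c_1E_2K_1^{-1},\qquad B_2=F_2-c_2E_1K_2^{-1}.$$ Its Cartan subalgebra is the subalgebra generated by $K^{\pm1}$ and $$C_1=B_1B_2-qB_2B_1-\frac{c_2}{q-q^{-1}}K+\frac{q+q^{-1}}{q-q^{-1}}c_1K^{-1},\qquad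 C_2=B_2B_1-qB_1B_2-\frac{c_1}{q-q^{-1}}K^{-1}+\frac{q+q^{-1}}{q-q^{-1}}c_2K.$$ A representation $(\tau,W)$ of $\mathcal B$ on a complex vector space is called a weight representation if $W$ is spanned by simultaneous eigenvectors of the Cartan subalgebra. A vector $w_0\ne0$ is a highest weight vector of weight $\kappa$ if $\tau(B_1)w_0=0$, $\tau(K)w_0=\kappa w_0$ and $q^{-3}\kappa$ is not in the spectrum of $\tau(K)$; then $\kappa$ is called a highest weight of $\tau$. Let $\mathbb N=\{0,1,2,\dots\}$ and $[j]_q=\frac{q^j-q^{-j}}{q-q^{-1}}$. 1. Every finite-dimensional irreducible representation of $\mathcal B$ is a weight representation and has exactly one highest weight $\kappa$, and $\kappa\in\mathbb C^\times$. 2. Two finite-dimensional irreducible representations of $\mathcal B$ with the same highest weight $\kappa$ and the same dimension $n+1$ are isomorphic. 3. Conversely, for all $\kappa\in\mathbb C^\times$ and $n\in\mathbb N$ with $\kappa^2\notin\{-c_1c_2^{-1}q^{1-m}: m\in\mathbb N\}$ there is an irreducible representation $(\tau_{(\kappa,n)},W_{(\kappa,n)})$ of $\mathcal B$ of dimension $n+1$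 with highest weight $\kappa$. More precisely, $W_{(\kappa,n)}$ has a basis $(w_j)_{j=0}^n$ such that $w_0$ is a highest weight vector of weight $\kappa$ and, writing $w_{-1}=w_{n+1}=0$, for $j=0,\dots,n$, $$\tau_{(\kappa,n)}(K)w_j=q^{3j}\kappa\, w_j,\qquad \tau_{(\kappa,n)}(B_2)w_j=w_{j+1},\qquad \tau_{(\kappa,n)}(B_1)w_j=b_jw_{j-1},$$ where $b_0=0$ and, for $1\le j\le n$, $$b_j=c_1\kappa^{-1}q^{-2n-1}[j]_q\,\frac{(1-q^{2n-2j+2})(1+c_2c_1^{-1}\kappa^2q^{2j+2n-1})}{q-q^{-1}}.$$ -/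

import Mathlib

noncomputable section

namespace QSP

/-- The symbols `E_i`, `F_i`, `K_i`, `K_i⁻¹` (`i = 1, 2`, indexed here by `0, 1 : Fin 2`). -/
inductive Gen : Type
  | E (i : Fin 2) : Gen
  | F (i : Fin 2) : Gen
  | K (i : Fin 2) : Gen
  | Kinv (i : Fin 2) : Gen

/-- The free unital associative complex algebra on the symbols. -/
abbrev Free : Type := FreeAlgebra ℂ Gen

/-- The symbol `E_i` as an element of the free algebra. -/
abbrev fE (i : Fin 2) : Free := FreeAlgebra.ι ℂ (Gen.E i)
/-- The symbol `F_i` as an element of the free algebra. -/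
abbrev fF (i : Fin 2) : Free := FreeAlgebra.ι ℂ (Gen.F i)
/-- The symbol `K_i` as an element of the free algebra. -/
abbrev fK (i : Fin 2) : Free := FreeAlgebra.ι ℂ (Gen.K i)
/-- The symbol `K_i⁻¹` as an element of the free algebra. -/
abbrev fKinv (i : Fin 2) : Free := FreeAlgebra.ι ℂ (Gen.Kinv i)

/-- The defining relations of the quantised universal enveloping algebra of type `A₂`;
`CartanMatrix.A 2 i j` is `(α_i, α_j)`, that is `2` if `i = j` and `-1` otherwise. -/
inductive Rel (q : ℂ) : Free → Free → Prop
  | K_mul_K (i j : Fin 2) : Rel q (fK i * fK j) (fK j * fK i)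
  | Kinv_mul_Kinv (i j : Fin 2) : Rel q (fKinv i * fKinv j) (fKinv j * fKinv i)
  | K_mul_Kinv_comm (i j : Fin 2) : Rel q (fK i * fKinv j) (fKinv j * fK i)
  | K_mul_Kinv (i : Fin 2) : Rel q (fK i * fKinv i) 1
  | Kinv_mul_K (i : Fin 2) : Rel q (fKinv i * fK i) 1
  | K_mul_E (i j : Fin 2) :
      Rel q (fK i * fE j) (q ^ (CartanMatrix.A 2 i j) • (fE j * fK i))
  | K_mul_F (i j : Fin 2) :
      Rel q (fK i * fF j) (q ^ (-(CartanMatrix.A 2 i j)) • (fF j * fK i))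
  | E_F_same (i : Fin 2) :
      Rel q (fE i * fF i - fF i * fE i) ((q - q⁻¹)⁻¹ • (fK i - fKinv i))
  | E_F_ne (i j : Fin 2) (hij : i ≠ j) : Rel q (fE i * fF j - fF j * fE i) 0
  | serre_E (i j : Fin 2) (hij : i ≠ j) :
      Rel q (fE i ^ 2 * fE j - (q + q⁻¹) • (fE i * fE j * fE i) + fE j * fE i ^ 2) 0
  | serre_F (i j : Fin 2) (hij : i ≠ j) :
      Rel q (fF i ^ 2 * fF j - (q + q⁻¹) • (fF i * fF j * fF i) + fF j * fF i ^ 2) 0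

/-- The quantised universal enveloping algebra `U_q(su(3))`, as a complex algebra. -/
abbrev Uq (q : ℂ) : Type := RingQuot (Rel q)

/-- The quotient map from the free algebra. -/
abbrev Uq.mk (q : ℂ) : Free →ₐ[ℂ] Uq q := RingQuot.mkAlgHom ℂ (Rel q)

/-- The generator `E_i` of `U_q(su(3))`. -/
def Uq.E (q : ℂ) (i : Fin 2) : Uq q := Uq.mk q (fE i)
/-- The generator `F_i` of `U_q(su(3))`. -/
def Uq.F (q : ℂ) (i : Fin 2) : Uq q := Uq.mk q (fF i)
/-- The generator `K_i` of `U_q(su(3))`. -/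
def Uq.K (q : ℂ) (i : Fin 2) : Uq q := Uq.mk q (fK i)
/-- The generator `K_i⁻¹` of `U_q(su(3))`. -/
def Uq.Kinv (q : ℂ) (i : Fin 2) : Uq q := Uq.mk q (fKinv i)

/-- `K = K₁ K₂⁻¹` in `U_q(su(3))`. -/
def uK (q : ℂ) : Uq q := Uq.K q 0 * Uq.Kinv q 1
/-- `K⁻¹ = K₂ K₁⁻¹` in `U_q(su(3))`. -/
def uKinv (q : ℂ) : Uq q := Uq.K q 1 * Uq.Kinv q 0
/-- `B₁ = F₁ - c₁ E₂ K₁⁻¹` in `U_q(su(3))`. -/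
def uB₁ (q c₁ : ℂ) : Uq q := Uq.F q 0 - c₁ • (Uq.E q 1 * Uq.Kinv q 0)
/-- `B₂ = F₂ - c₂ E₁ K₂⁻¹` in `U_q(su(3))`. -/
def uB₂ (q c₂ : ℂ) : Uq q := Uq.F q 1 - c₂ • (Uq.E q 0 * Uq.Kinv q 1)

/-- The right coideal subalgebra `𝓑 = 𝓑_c`, `c = (c₁, c₂)`, generated by `K`, `K⁻¹`, `B₁`, `B₂`. -/
def B (q c₁ c₂ : ℂ) : Subalgebra ℂ (Uq q) :=
  Algebra.adjoin ℂ {uK q, uKinv q, uB₁ q c₁, uB₂ q c₂}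

namespace B

/-- `K` as an element of `𝓑`. -/
def K (q c₁ c₂ : ℂ) : B q c₁ c₂ := ⟨uK q, Algebra.subset_adjoin (by simp)⟩
/-- `K⁻¹` as an element of `𝓑`. -/
def Kinv (q c₁ c₂ : ℂ) : B q c₁ c₂ := ⟨uKinv q, Algebra.subset_adjoin (by simp)⟩
/-- `B₁` as an element of `𝓑`. -/
def B₁ (q c₁ c₂ : ℂ) : B q c₁ c₂ := ⟨uB₁ q c₁, Algebra.subset_adjoin (by simp)⟩
/-- `B₂` as an element of `𝓑`. -/
def B₂ (q c₁ c₂ : ℂ) : B q c₁ c₂ := ⟨uB₂ q c₂, Algebra.subset_adjoin (by simp)⟩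

/-- `C₁ = B₁B₂ - q B₂B₁ - (q - q⁻¹)⁻¹ c₂ K + (q + q⁻¹)(q - q⁻¹)⁻¹ c₁ K⁻¹`. -/
def C₁ (q c₁ c₂ : ℂ) : B q c₁ c₂ :=
  B₁ q c₁ c₂ * B₂ q c₁ c₂ - q • (B₂ q c₁ c₂ * B₁ q c₁ c₂)
    - (1 / (q - q⁻¹) * c₂) • K q c₁ c₂ + ((q + q⁻¹) / (q - q⁻¹) * c₁) • Kinv q c₁ c₂

/-- `C₂ = B₂B₁ - q B₁B₂ - (q - q⁻¹)⁻¹ c₁ K⁻¹ + (q + q⁻¹)(q - q⁻¹)⁻¹ c₂ K`. -/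
def C₂ (q c₁ c₂ : ℂ) : B q c₁ c₂ :=
  B₂ q c₁ c₂ * B₁ q c₁ c₂ - q • (B₁ q c₁ c₂ * B₂ q c₁ c₂)
    - (1 / (q - q⁻¹) * c₁) • Kinv q c₁ c₂ + ((q + q⁻¹) / (q - q⁻¹) * c₂) • K q c₁ c₂

/-- The Cartan subalgebra of `𝓑`, generated by `K`, `K⁻¹`, `C₁` and `C₂`. -/
def cartan (q c₁ c₂ : ℂ) : Subalgebra ℂ (B q c₁ c₂) :=
  Algebra.adjoin ℂ {K q c₁ c₂, Kinv q c₁ c₂, C₁ q c₁ c₂, C₂ q c₁ c₂}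

end B

variable {q c₁ c₂ : ℂ} {W : Type*} [AddCommGroup W] [Module ℂ W]

/-- The underlying representation, in Mathlib's sense, of the multiplicative monoid of `𝓑`.
A linear subspace is stable under it iff it is a `𝓑`-submodule, and a linear map intertwines
two of them iff it is a morphism of representations of `𝓑`. -/
abbrev toRep (τ : B q c₁ c₂ →ₐ[ℂ] Module.End ℂ W) : Representation ℂ (B q c₁ c₂) W :=
  (τ : B q c₁ c₂ →* Module.End ℂ W)

/-- `τ` is irreducible: `W ≠ 0`, and `0` and `W` are the only `𝓑`-stable subspaces. -/
abbrev IsIrreducible (τ : B q c₁ c₂ →ₐ[ℂ] Module.End ℂ W) : Prop :=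
  (toRep τ).IsIrreducible

/-- `τ` is a weight representation: `W` is spanned by simultaneous eigenvectors of the
Cartan subalgebra of `𝓑` (equivalently, `W` is the sum of its weight spaces). -/
def IsWeightRep (τ : B q c₁ c₂ →ₐ[ℂ] Module.End ℂ W) : Prop :=
  Submodule.span ℂ {w : W | ∀ h ∈ B.cartan q c₁ c₂, ∃ a : ℂ, τ h w = a • w} = ⊤

/-- `w₀` is a highest weight vector of `τ` of weight `κ`: `w₀ ≠ 0`, `τ(B₁) w₀ = 0`,
`τ(K) w₀ = κ w₀`, and `q⁻³ κ` does not lie in the spectrum of `τ(K)`. -/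
structure IsHighestWeightVector (τ : B q c₁ c₂ →ₐ[ℂ] Module.End ℂ W) (κ : ℂ) (w₀ : W) :
    Prop where
  ne_zero : w₀ ≠ 0
  B₁_apply : τ (B.B₁ q c₁ c₂) w₀ = 0
  K_apply : τ (B.K q c₁ c₂) w₀ = κ • w₀
  not_mem_spectrum : q ^ (-3 : ℤ) * κ ∉ spectrum ℂ (τ (B.K q c₁ c₂))

/-- `κ` is a highest weight of `τ`. -/
def IsHighestWeight (τ : B q c₁ c₂ →ₐ[ℂ] Module.End ℂ W) (κ : ℂ) : Prop :=
  ∃ w₀ : W, IsHighestWeightVector τ κ w₀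

/-- The `q`-number `[j]_q = (q^j - q^{-j}) / (q - q⁻¹)`. -/
def qNumber (q : ℂ) (j : ℕ) : ℂ := (q ^ j - (q ^ j)⁻¹) / (q - q⁻¹)

/-- The coefficient
`b_j = c₁ κ⁻¹ q^{-2n-1} [j]_q (1 - q^{2n-2j+2}) (1 + c₂ c₁⁻¹ κ² q^{2j+2n-1}) / (q - q⁻¹)`. -/
def bCoeff (q c₁ c₂ κ : ℂ) (n j : ℕ) : ℂ :=
  c₁ * κ⁻¹ * q ^ (-2 * (n : ℤ) - 1) * qNumber q j *
    ((1 - q ^ (2 * (n : ℤ) - 2 * (j : ℤ) + 2)) *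
      (1 + c₂ * c₁⁻¹ * κ ^ 2 * q ^ (2 * (j : ℤ) + 2 * (n : ℤ) - 1)) / (q - q⁻¹))

end QSP

end

/-! The engine is the deformed Serre relation of `𝓑` quadratic in `B₂`. If `w_j = B₂^j w_0` starts
at a vector of weight `κ` with `B₁ w_0 = 0` and `B₁B₂ w_0 = β w_0`, the relation makes `B₁ w_{j+1} =
b_{j+1} w_j`, where `b` solves an inhomogeneous second-order recursion with `b_0 = 0`, `b_1 = β`
(`isLadder_pow`). So the `w_j` span a `𝓑`-stable space.

In a finite-dimensional irreducible `W` such a start exists: take `κ` of maximal modulus in the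
spectrum of `K`, and an eigenvector of `B₁B₂` in the `κ`-eigenspace. The ladder spans `W`, its
weights `q^{3j}κ` are distinct, and only the bottom one can be a highest weight. If `dim W = n + 1`,
then `w_{n+1} = 0` forces `b_{n+1} = 0`. Two solutions of the recursion differ by `[j]_q (β - β')`,
so `κ` and `n` determine `β`, hence all structure constants (`nonempty_equiv`).

For existence, `𝓑` is given as a subalgebra, not by a presentation, so the module is cut out of a
representation of `U_q(su(3))`. A `q`-oscillator module with formal infinite sums contains a vector
of weight `κ` killed by `B₁` on which `B₁B₂` is any prescribed `β` (`Osc.exists_vector`). For `β =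
b_1` the closed form gives `b_{n+1} = 0`, so `B₁ w_{n+1} = 0`, and a support argument gives `w_{n+1}
= 0` (`Osc.isLadder_eq_zero`). The condition on `κ²` keeps `b_1, …, b_n` nonzero, which gives
dimension `n + 1` and irreducibility. -/

noncomputable section

namespace QSP

/-! ### Relations in `U_q(su(3))` and the deformed Serre relation -/

/-- The deformed Serre relation quadratic in `Z - c₂ T`, derived from the commutation relations between the
summands `Z`, `T` of `Z - c₂ T` and `X`, `Y` of `X - c₁ Y`. -/
theorem deformed_serre {A : Type*} [Ring A] [Algebra ℂ A] {q : ℂ} (c₁ c₂ : ℂ)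
    (hq : q ≠ 0) (hq2 : q ^ 2 - 1 ≠ 0) {X Y Z T K K' L : A}
    (hZX : Z ^ 2 * X - (q + q⁻¹) • (Z * X * Z) + X * Z ^ 2 = 0)
    (hTY : T ^ 2 * Y - (q + q⁻¹) • (T * Y * T) + Y * T ^ 2 = 0)
    (hYZ : Y * Z = q⁻¹ • (Z * Y) + (q⁻¹ * (q - q⁻¹)⁻¹) • (K' - L))
    (hTX : T * X = q⁻¹ • (X * T) + (q⁻¹ * (q - q⁻¹)⁻¹) • (K - L))
    (hTZ : T * Z = q ^ 2 • (Z * T))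
    (hKZ : K * Z = q ^ 3 • (Z * K)) (hKT : K * T = q ^ 3 • (T * K))
    (hK'Z : K' * Z = (q ^ 3)⁻¹ • (Z * K')) (hK'T : K' * T = (q ^ 3)⁻¹ • (T * K'))
    (hLZ : L * Z = q • (Z * L)) (hLT : L * T = q⁻¹ • (T * L)) :
    (Z - c₂ • T) * (Z - c₂ • T) * (X - c₁ • Y)
      - (q + q⁻¹) • ((Z - c₂ • T) * (X - c₁ • Y) * (Z - c₂ • T))
      + (X - c₁ • Y) * (Z - c₂ • T) * (Z - c₂ • T)
      = (q + q⁻¹) • ((Z - c₂ • T) * ((c₂ * q) • K + (c₁ * (q ^ 2)⁻¹) • K')) := by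
  have e1 : X * (Z * Z) = (q + q⁻¹) • (Z * (X * Z)) - Z * (Z * X) := by
    simp only [pow_two, mul_assoc] at hZX
    rw [← sub_eq_zero, ← hZX]; abel
  have e2 : Y * (T * T) = (q + q⁻¹) • (T * (Y * T)) - T * (T * Y) := by
    simp only [pow_two, mul_assoc] at hTY
    rw [← sub_eq_zero, ← hTY]; abel
  have aYZ (x : A) : Y * (Z * x) = (q⁻¹ • (Z * Y) + (q⁻¹ * (q - q⁻¹)⁻¹) • (K' - L)) * x := by
    rw [← mul_assoc, hYZ]
  have aTX (x : A) : T * (X * x) = (q⁻¹ • (X * T) + (q⁻¹ * (q - q⁻¹)⁻¹) • (K - L)) * x := by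
    rw [← mul_assoc, hTX]
  have aTZ (x : A) : T * (Z * x) = (q ^ 2 • (Z * T)) * x := by rw [← mul_assoc, hTZ]
  have hd : q - q⁻¹ ≠ 0 := by
    intro h; apply hq2; field_simp at h; linear_combination h
  -- All words are brought to a normal form: `T` moves right past `X` and `Z`, `Y` right past `Z`,
  -- Cartan elements to the far right, and the two Serre relations eliminate `X Z²` and `Y T²`. What
  -- remains is a comparison of coefficients, in which the `L` terms cancel.
  simp only [mul_sub, sub_mul, mul_add, add_mul, smul_mul_assoc, mul_smul_comm, mul_assoc,
    hYZ, hTX, hTZ, aYZ, aTX, aTZ, hKZ, hKT, hK'Z, hK'T, hLZ, hLT, e1, e2]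
  match_scalars <;> field_simp <;> ring

variable {q : ℂ}

theorem Uq.Kinv_mul_K (i : Fin 2) : Uq.Kinv q i * Uq.K q i = 1 := by
  simpa [Uq.E, Uq.F, Uq.K, Uq.Kinv] using RingQuot.mkAlgHom_rel ℂ (Rel.Kinv_mul_K (q := q) i)

theorem Uq.K_mul_Kinv (i : Fin 2) : Uq.K q i * Uq.Kinv q i = 1 := by
  simpa [Uq.E, Uq.F, Uq.K, Uq.Kinv] using RingQuot.mkAlgHom_rel ℂ (Rel.K_mul_Kinv (q := q) i)

theorem Uq.K_mul_Kinv_comm (i j : Fin 2) : Uq.K q i * Uq.Kinv q j = Uq.Kinv q j * Uq.K q i := by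
  simpa [Uq.E, Uq.F, Uq.K, Uq.Kinv] using RingQuot.mkAlgHom_rel ℂ (Rel.K_mul_Kinv_comm (q := q) i j)

theorem Uq.Kinv_mul_Kinv (i j : Fin 2) :
    Uq.Kinv q i * Uq.Kinv q j = Uq.Kinv q j * Uq.Kinv q i := by
  simpa [Uq.E, Uq.F, Uq.K, Uq.Kinv] using RingQuot.mkAlgHom_rel ℂ (Rel.Kinv_mul_Kinv (q := q) i j)

theorem Uq.K_mul_E (i j : Fin 2) :
    Uq.K q i * Uq.E q j = q ^ (CartanMatrix.A 2 i j) • (Uq.E q j * Uq.K q i) := by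
  simpa [Uq.E, Uq.F, Uq.K, Uq.Kinv] using RingQuot.mkAlgHom_rel ℂ (Rel.K_mul_E (q := q) i j)

theorem Uq.K_mul_F (i j : Fin 2) :
    Uq.K q i * Uq.F q j = q ^ (-(CartanMatrix.A 2 i j)) • (Uq.F q j * Uq.K q i) := by
  simpa [Uq.E, Uq.F, Uq.K, Uq.Kinv] using RingQuot.mkAlgHom_rel ℂ (Rel.K_mul_F (q := q) i j)

theorem Uq.E_mul_F_same (i : Fin 2) :
    Uq.E q i * Uq.F q i - Uq.F q i * Uq.E q i = (q - q⁻¹)⁻¹ • (Uq.K q i - Uq.Kinv q i) := by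
  simpa [Uq.E, Uq.F, Uq.K, Uq.Kinv] using RingQuot.mkAlgHom_rel ℂ (Rel.E_F_same (q := q) i)

theorem Uq.serre_E (i j : Fin 2) (hij : i ≠ j) :
    Uq.E q i ^ 2 * Uq.E q j - (q + q⁻¹) • (Uq.E q i * Uq.E q j * Uq.E q i)
      + Uq.E q j * Uq.E q i ^ 2 = 0 := by
  simpa [Uq.E, Uq.F, Uq.K, Uq.Kinv] using RingQuot.mkAlgHom_rel ℂ (Rel.serre_E (q := q) i j hij)

theorem Uq.serre_F (i j : Fin 2) (hij : i ≠ j) :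
    Uq.F q i ^ 2 * Uq.F q j - (q + q⁻¹) • (Uq.F q i * Uq.F q j * Uq.F q i)
      + Uq.F q j * Uq.F q i ^ 2 = 0 := by
  simpa [Uq.E, Uq.F, Uq.K, Uq.Kinv] using RingQuot.mkAlgHom_rel ℂ (Rel.serre_F (q := q) i j hij)

/-- If `k x = a x k` and `k' k = 1 = k k'`, then `k' x = a⁻¹ x k'`. -/
theorem inv_qcommute {A : Type*} [Ring A] [Algebra ℂ A] {a : ℂ} (ha : a ≠ 0) {k k' x : A}
    (h₁ : k' * k = 1) (h₂ : k * k' = 1) (h : k * x = a • (x * k)) :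
    k' * x = a⁻¹ • (x * k') := by
  calc k' * x = a⁻¹ • (k' * (a • (x * k)) * k') := by
        simp only [mul_smul_comm, smul_mul_assoc, mul_assoc, h₂, mul_one, inv_smul_smul₀ ha]
    _ = a⁻¹ • (x * k') := by rw [← h, ← mul_assoc, h₁, one_mul]

theorem Uq.Kinv_mul_E (hq : q ≠ 0) (i j : Fin 2) :
    Uq.Kinv q i * Uq.E q j = q ^ (-(CartanMatrix.A 2 i j)) • (Uq.E q j * Uq.Kinv q i) := by
  rw [zpow_neg]
  exact inv_qcommute (zpow_ne_zero _ hq) (Uq.Kinv_mul_K i) (Uq.K_mul_Kinv i) (Uq.K_mul_E i j)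

theorem Uq.Kinv_mul_F (hq : q ≠ 0) (i j : Fin 2) :
    Uq.Kinv q i * Uq.F q j = q ^ (CartanMatrix.A 2 i j) • (Uq.F q j * Uq.Kinv q i) := by
  have := inv_qcommute (zpow_ne_zero _ hq) (Uq.Kinv_mul_K i) (Uq.K_mul_Kinv i) (Uq.K_mul_F i j)
  rwa [← zpow_neg, neg_neg] at this

theorem uK_mul_uKinv : uK q * uKinv q = 1 := by
  simp only [uK, uKinv]
  rw [mul_assoc, ← mul_assoc (Uq.Kinv q 1), Uq.Kinv_mul_K, one_mul, Uq.K_mul_Kinv]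

theorem uKinv_mul_uK : uKinv q * uK q = 1 := by
  simp only [uK, uKinv]
  rw [mul_assoc, ← mul_assoc (Uq.Kinv q 0), Uq.Kinv_mul_K, one_mul, Uq.K_mul_Kinv]

theorem cartan_A_two :
    CartanMatrix.A 2 0 0 = 2 ∧ CartanMatrix.A 2 0 1 = -1 ∧ CartanMatrix.A 2 1 0 = -1 ∧
      CartanMatrix.A 2 1 1 = 2 := by
  refine ⟨?_, ?_, ?_, ?_⟩ <;> decide

theorem Uq.E_mul_F_ne (i j : Fin 2) (hij : i ≠ j) :
    Uq.E q i * Uq.F q j = Uq.F q j * Uq.E q i := by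
  rw [← sub_eq_zero]
  simpa [Uq.E, Uq.F, Uq.K, Uq.Kinv] using RingQuot.mkAlgHom_rel ℂ (Rel.E_F_ne (q := q) i j hij)

theorem mul_mul_of_eq {A : Type*} [Ring A] [Algebra ℂ A] {x y z : A} {a : ℂ}
    (h : x * y = a • z) (w : A) : x * (y * w) = a • (z * w) := by
  rw [← mul_assoc, h, smul_mul_assoc]

theorem mul_mul_of_comm {A : Type*} [Ring A] {x y : A}
    (h : x * y = y * x) (w : A) : x * (y * w) = y * (x * w) := by
  rw [← mul_assoc, h, mul_assoc]

/-- The deformed Serre relation of `𝓑` that is quadratic in `B₂`. -/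
theorem uB₂_serre (c₁ c₂ : ℂ) (hq : q ≠ 0) (hq2 : q ^ 2 - 1 ≠ 0) :
    uB₂ q c₂ * uB₂ q c₂ * uB₁ q c₁ - (q + q⁻¹) • (uB₂ q c₂ * uB₁ q c₁ * uB₂ q c₂)
      + uB₁ q c₁ * uB₂ q c₂ * uB₂ q c₂
      = (q + q⁻¹) • (uB₂ q c₂ * ((c₂ * q) • uK q + (c₁ * (q ^ 2)⁻¹) • uKinv q)) := by
  obtain ⟨h00, h01, h10, h11⟩ := cartan_A_two
  have KE := fun i j ↦ Uq.K_mul_E (q := q) i j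
  have KF := fun i j ↦ Uq.K_mul_F (q := q) i j
  have K'E := fun i j ↦ Uq.Kinv_mul_E hq i j
  have K'F := fun i j ↦ Uq.Kinv_mul_F hq i j
  have aKE := fun i j ↦ mul_mul_of_eq (KE i j)
  have aK'E := fun i j ↦ mul_mul_of_eq (K'E i j)
  have aK'F := fun i j ↦ mul_mul_of_eq (K'F i j)
  have c01 := Uq.Kinv_mul_Kinv (q := q) 1 0
  have ac01 := mul_mul_of_comm c01
  have ck := fun i j ↦ Uq.K_mul_Kinv_comm (q := q) i j
  have EF (i : Fin 2) : Uq.E q i * Uq.F q i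
      = Uq.F q i * Uq.E q i + (q - q⁻¹)⁻¹ • (Uq.K q i - Uq.Kinv q i) := by
    rw [← Uq.E_mul_F_same]; abel
  have EF01 := Uq.E_mul_F_ne (q := q) 0 1 (by decide)
  have aEF01 := mul_mul_of_comm EF01
  have aEF (i : Fin 2) (x : Uq q) : Uq.E q i * (Uq.F q i * x)
      = (Uq.F q i * Uq.E q i + (q - q⁻¹)⁻¹ • (Uq.K q i - Uq.Kinv q i)) * x := by
    rw [← mul_assoc, EF]
  apply deformed_serre c₁ c₂ hq hq2 (L := Uq.Kinv q 0 * Uq.Kinv q 1)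
  · exact Uq.serre_F 1 0 (by decide)
  -- Here `T = E₁K₂⁻¹` and `Y = E₂K₁⁻¹`. Collecting the Cartan factors on the right costs `q⁻³` in
  -- each of the three cubic terms, so the relation is the Serre relation for `E` times `q⁻³
  -- K₁⁻¹K₂⁻²`.
  · have h := congrArg (fun x ↦ x * (Uq.Kinv q 0 * (Uq.Kinv q 1 * Uq.Kinv q 1)))
      (Uq.serre_E (q := q) 0 1 (by decide))
    have h' := congrArg (fun x ↦ (q ^ 3)⁻¹ • x) h
    simp only [pow_two, zero_mul, smul_zero] at h'
    rw [← h']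
    simp only [pow_two, mul_assoc, sub_mul, add_mul, smul_mul_assoc, mul_smul_comm, aK'E, h00,
      h10, h11, c01, ac01, neg_neg]
    match_scalars <;> field_simp
  all_goals
    simp only [uK, uKinv, mul_assoc, sub_mul, add_mul, smul_mul_assoc, mul_smul_comm, aK'E, K'F,
      aK'F, aKE, KF, h00, h01, h10, h11, c01, ac01, ck, neg_neg, aEF, aEF01]
    match_scalars <;> field_simp

theorem uK_mul_uB (c₁ c₂ : ℂ) (hq : q ≠ 0) :
    uK q * uB₁ q c₁ = (q ^ 3)⁻¹ • (uB₁ q c₁ * uK q) ∧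
      uK q * uB₂ q c₂ = q ^ 3 • (uB₂ q c₂ * uK q) := by
  obtain ⟨h00, h01, h10, h11⟩ := cartan_A_two
  have KE := fun i j ↦ Uq.K_mul_E (q := q) i j
  have KF := fun i j ↦ Uq.K_mul_F (q := q) i j
  have K'E := fun i j ↦ Uq.Kinv_mul_E hq i j
  have K'F := fun i j ↦ Uq.Kinv_mul_F hq i j
  have aKE := fun i j ↦ mul_mul_of_eq (KE i j)
  have aK'E := fun i j ↦ mul_mul_of_eq (K'E i j)
  have aK'F := fun i j ↦ mul_mul_of_eq (K'F i j)
  have c01 := Uq.Kinv_mul_Kinv (q := q) 1 0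
  have ac01 := mul_mul_of_comm c01
  have ck := fun i j ↦ Uq.K_mul_Kinv_comm (q := q) i j
  constructor <;>
  · simp only [uK, uB₁, uB₂, mul_assoc, mul_sub, sub_mul, smul_mul_assoc, smul_sub,
      mul_smul_comm, aK'E, aK'F, aKE, KF, h00, h01, h10, h11, ac01, ck, neg_neg]
    match_scalars <;> field_simp

/-! ### Relations and induction inside `𝓑` -/

section Generators

variable {q c₁ c₂ : ℂ}

namespace B

/-- An induction principle for elements of `𝓑`. -/
theorem induction {p : B q c₁ c₂ → Prop} (hK : p (K q c₁ c₂)) (hKinv : p (Kinv q c₁ c₂))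
    (h₁ : p (B₁ q c₁ c₂)) (h₂ : p (B₂ q c₁ c₂)) (halg : ∀ r : ℂ, p (algebraMap ℂ _ r))
    (hadd : ∀ x y, p x → p y → p (x + y)) (hmul : ∀ x y, p x → p y → p (x * y))
    (b : B q c₁ c₂) : p b := by
  obtain ⟨x, hx⟩ := b
  induction hx using Algebra.adjoin_induction with
  | mem x hx =>
    rcases hx with rfl | rfl | rfl | rfl
    exacts [hK, hKinv, h₁, h₂]
  | algebraMap r => exact halg r
  | add x y hx hy h h' => exact hadd _ _ h h'
  | mul x y hx hy h h' => exact hmul _ _ h h'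

theorem Kinv_mul_K : Kinv q c₁ c₂ * K q c₁ c₂ = 1 := Subtype.ext uKinv_mul_uK

theorem K_mul_Kinv : K q c₁ c₂ * Kinv q c₁ c₂ = 1 := Subtype.ext uK_mul_uKinv

theorem K_mul_B₁ (hq : q ≠ 0) :
    K q c₁ c₂ * B₁ q c₁ c₂ = (q ^ 3)⁻¹ • (B₁ q c₁ c₂ * K q c₁ c₂) :=
  Subtype.ext (uK_mul_uB c₁ c₂ hq).1

theorem K_mul_B₂ (hq : q ≠ 0) :
    K q c₁ c₂ * B₂ q c₁ c₂ = q ^ 3 • (B₂ q c₁ c₂ * K q c₁ c₂) :=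
  Subtype.ext (uK_mul_uB c₁ c₂ hq).2

theorem serre_B₂ (hq : q ≠ 0) (hq2 : q ^ 2 - 1 ≠ 0) :
    B₂ q c₁ c₂ * B₂ q c₁ c₂ * B₁ q c₁ c₂
      - (q + q⁻¹) • (B₂ q c₁ c₂ * B₁ q c₁ c₂ * B₂ q c₁ c₂)
      + B₁ q c₁ c₂ * B₂ q c₁ c₂ * B₂ q c₁ c₂
      = (q + q⁻¹) • (B₂ q c₁ c₂ *
          ((c₂ * q) • K q c₁ c₂ + (c₁ * (q ^ 2)⁻¹) • Kinv q c₁ c₂)) :=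
  Subtype.ext (uB₂_serre c₁ c₂ hq hq2)

end B

end Generators

/-! ### Ladders and their structure constants -/

/-- The coefficients `b_j` with `B₁ B₂ w_j = b_{j+1} w_j` on the `𝓑`-module generated by a vector
`w_0` of weight `κ` with `B₁ w_0 = 0` and `B₁ B₂ w_0 = β w_0`. -/
def ladderCoeff (q c₁ c₂ κ β : ℂ) : ℕ → ℂ
  | 0 => 0
  | 1 => β
  | j + 2 => (q + q⁻¹) * ladderCoeff q c₁ c₂ κ β (j + 1) - ladderCoeff q c₁ c₂ κ β j
      + (q + q⁻¹) * (c₂ * q * (q ^ (3 * j) * κ) + c₁ * (q ^ 2)⁻¹ * (q ^ (3 * j) * κ)⁻¹)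

theorem qNumber_add_two {q : ℂ} (hq : q ≠ 0) (j : ℕ) :
    qNumber q (j + 2) = (q + q⁻¹) * qNumber q (j + 1) - qNumber q j := by
  simp only [qNumber, div_eq_mul_inv]
  generalize (q - q⁻¹)⁻¹ = s
  field_simp
  ring

/-- The inhomogeneous term does not involve `β`, so the difference solves the homogeneous recursion,
as `[j]_q` does. -/
theorem ladderCoeff_sub {q c₁ c₂ κ : ℂ} (hq : q ≠ 0) (hq2 : q ^ 2 - 1 ≠ 0) (β β' : ℂ) (j : ℕ) :
    ladderCoeff q c₁ c₂ κ β j - ladderCoeff q c₁ c₂ κ β' j = qNumber q j * (β - β') := by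
  induction j using Nat.twoStepInduction with
  | zero => simp [ladderCoeff, qNumber]
  | one =>
    have hd : q - q⁻¹ ≠ 0 := by
      intro h; apply hq2; field_simp at h; linear_combination h
    simp [ladderCoeff, qNumber, div_self hd]
  | more j h₀ h₁ =>
    rw [ladderCoeff, ladderCoeff, qNumber_add_two hq]
    linear_combination (q + q⁻¹) * h₁ - h₀

theorem qNumber_ne_zero {q : ℂ} (hq : q ≠ 0) (hq1 : ‖q‖ < 1) {j : ℕ} (hj : j ≠ 0) :
    qNumber q j ≠ 0 := by
  have key (i : ℕ) (hi : i ≠ 0) : q ^ i - (q ^ i)⁻¹ ≠ 0 := by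
    intro h
    have h2 : q ^ (i + i) = 1 := by
      have : q ^ i ≠ 0 := pow_ne_zero _ hq
      field_simp at h
      rw [pow_add]; linear_combination h
    have h3 := congrArg norm h2
    rw [norm_pow, norm_one] at h3
    exact (pow_lt_one₀ (norm_nonneg q) hq1 (by omega)).ne h3
  exact div_ne_zero (key j hj) (by simpa using key 1 one_ne_zero)

variable {q c₁ c₂ : ℂ} {W : Type*} [AddCommGroup W] [Module ℂ W]

/-- `w_0, w_1, …` is a string of `K`-eigenvectors, raised by `B₂` and lowered by `B₁`. -/
structure IsLadder (k b₁ b₂ : Module.End ℂ W) (q κ : ℂ) (b : ℕ → ℂ) (w : ℕ → W) : Prop where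
  K_apply : ∀ j, k (w j) = (q ^ (3 * j) * κ) • w j
  B₂_apply : ∀ j, b₂ (w j) = w (j + 1)
  B₁_zero : b₁ (w 0) = 0
  B₁_succ : ∀ j, b₁ (w (j + 1)) = b (j + 1) • w j

/-- Applied to `w_j`, the three terms of the Serre relation become `b_j`, `b_{j+1}`, `b_{j+2}` times
`w_{j+1}`, and its right side is a multiple of `w_{j+1}` fixed by the weight. -/
theorem isLadder_pow {k k' b₁ b₂ : Module.End ℂ W} {κ β : ℂ} (hq : q ≠ 0) (hκ : κ ≠ 0)
    (hk' : k' * k = 1) (hk : k * b₂ = q ^ 3 • (b₂ * k))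
    (hserre : b₂ * b₂ * b₁ - (q + q⁻¹) • (b₂ * b₁ * b₂) + b₁ * b₂ * b₂
      = (q + q⁻¹) • (b₂ * ((c₂ * q) • k + (c₁ * (q ^ 2)⁻¹) • k')))
    {v : W} (hv : k v = κ • v) (hv₁ : b₁ v = 0) (hv₂ : b₁ (b₂ v) = β • v) :
    IsLadder k b₁ b₂ q κ (ladderCoeff q c₁ c₂ κ β) (fun j ↦ (b₂ ^ j) v) := by
  have hB₂ (j : ℕ) : b₂ ((b₂ ^ j) v) = (b₂ ^ (j + 1)) v := by
    rw [pow_succ']; rfl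
  have hK (j : ℕ) : k ((b₂ ^ j) v) = (q ^ (3 * j) * κ) • (b₂ ^ j) v := by
    induction j with
    | zero => simpa using hv
    | succ j ih =>
      have h := LinearMap.congr_fun hk ((b₂ ^ j) v)
      simp only [Module.End.mul_apply, LinearMap.smul_apply, ih, map_smul, hB₂] at h
      rw [h, smul_smul]; congr 1; ring
  have hK' (j : ℕ) : k' ((b₂ ^ j) v) = (q ^ (3 * j) * κ)⁻¹ • (b₂ ^ j) v := by
    have hne : q ^ (3 * j) * κ ≠ 0 := mul_ne_zero (pow_ne_zero _ hq) hκ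
    have h := LinearMap.congr_fun hk' ((b₂ ^ j) v)
    simp only [Module.End.mul_apply, hK, map_smul, Module.End.one_apply] at h
    rw [eq_inv_smul_iff₀ hne, h]
  refine ⟨hK, hB₂, by simpa using hv₁, fun j ↦ ?_⟩
  -- Carrying `b₂ b₁ w_j` along supplies the second piece of data for the recursion and avoids a
  -- `w_{-1}` at `j = 0`.
  suffices h : b₁ ((b₂ ^ (j + 1)) v) = ladderCoeff q c₁ c₂ κ β (j + 1) • (b₂ ^ j) v ∧
      b₂ (b₁ ((b₂ ^ j) v)) = ladderCoeff q c₁ c₂ κ β j • (b₂ ^ j) v from h.1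
  induction j with
  | zero => simpa [ladderCoeff, hv₁] using hv₂
  | succ j ih =>
    obtain ⟨ih₁, ih₀⟩ := ih
    refine ⟨?_, by rw [ih₁, map_smul, hB₂]⟩
    have h := LinearMap.congr_fun hserre ((b₂ ^ j) v)
    simp only [Module.End.mul_apply, LinearMap.smul_apply, LinearMap.add_apply,
      LinearMap.sub_apply, ih₀, ih₁, map_smul, map_add, hB₂, hK, hK'] at h
    rw [ladderCoeff]
    have h' := eq_sub_of_add_eq' h
    rw [h']
    module

namespace IsLadder

variable {k k' b₁ b₂ : Module.End ℂ W} {κ : ℂ} {b : ℕ → ℂ} {w : ℕ → W}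

theorem K_inv_apply (h : IsLadder k b₁ b₂ q κ b w) (hq : q ≠ 0) (hκ : κ ≠ 0)
    (hk' : k' * k = 1) (j : ℕ) : k' (w j) = (q ^ (3 * j) * κ)⁻¹ • w j := by
  have h' := LinearMap.congr_fun hk' (w j)
  simp only [Module.End.mul_apply, h.K_apply, map_smul, Module.End.one_apply] at h'
  rw [eq_inv_smul_iff₀ (mul_ne_zero (pow_ne_zero _ hq) hκ), h']

theorem weight_injective (hq : q ≠ 0) (hq1 : ‖q‖ < 1) (hκ : κ ≠ 0) :
    Function.Injective fun j : ℕ ↦ q ^ (3 * j) * κ := by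
  intro i j hij
  have h := congrArg norm (mul_right_cancel₀ hκ hij)
  rw [norm_pow, norm_pow] at h
  have := (pow_right_inj₀ (norm_pos_iff.2 hq) hq1.ne).1 h
  omega

theorem linearIndependent (h : IsLadder k b₁ b₂ q κ b w) (hq : q ≠ 0) (hq1 : ‖q‖ < 1)
    (hκ : κ ≠ 0) {ι : Type*} {f : ι → ℕ} (hf : Function.Injective f) (hw : ∀ i, w (f i) ≠ 0) :
    LinearIndependent ℂ (fun i ↦ w (f i)) :=
  Module.End.eigenvectors_linearIndependent' k (fun i ↦ q ^ (3 * f i) * κ)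
    ((weight_injective hq hq1 hκ).comp hf) _
    fun i ↦ ⟨Module.End.mem_eigenspace_iff.2 (h.K_apply _), hw i⟩

theorem eq_zero_of_le (h : IsLadder k b₁ b₂ q κ b w) {i j : ℕ} (hij : i ≤ j) (hi : w i = 0) :
    w j = 0 := by
  induction j, hij using Nat.le_induction with
  | base => exact hi
  | succ j _ ih => rw [← h.B₂_apply, ih, map_zero]

/-- The truncation condition that later fixes `β`. -/
theorem coeff_eq_zero (h : IsLadder k b₁ b₂ q κ b w) {n : ℕ} (h0 : w n ≠ 0)
    (h1 : w (n + 1) = 0) : b (n + 1) = 0 := by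
  have h' := h.B₁_succ n
  rw [h1, map_zero] at h'
  exact (smul_eq_zero.1 h'.symm).resolve_right h0

/-- A ladder spanning a finite-dimensional space consists of a basis followed by zeros. -/
theorem exists_basis [FiniteDimensional ℂ W] (h : IsLadder k b₁ b₂ q κ b w) (hq : q ≠ 0)
    (hq1 : ‖q‖ < 1) (hκ : κ ≠ 0) (h0 : w 0 ≠ 0) (hspan : Submodule.span ℂ (Set.range w) = ⊤) :
    ∃ n : ℕ, (∀ j, n < j → w j = 0) ∧
      ∃ e : Module.Basis (Fin (n + 1)) ℂ W, ∀ j, e j = w j := by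
  classical
  have hex : ∃ n, w n = 0 := by
    by_contra! hne
    have := (h.linearIndependent hq hq1 hκ Function.injective_id hne).finite
    exact not_finite ℕ
  obtain ⟨n, hn⟩ : ∃ n, Nat.find hex = n + 1 :=
    Nat.exists_eq_succ_of_ne_zero fun h' ↦ h0 (h' ▸ Nat.find_spec hex)
  have hzero (j : ℕ) (hj : n < j) : w j = 0 :=
    h.eq_zero_of_le (i := n + 1) hj (hn ▸ Nat.find_spec hex)
  have hli : LinearIndependent ℂ (fun j : Fin (n + 1) ↦ w j) :=
    h.linearIndependent hq hq1 hκ Fin.val_injective fun j ↦ Nat.find_min hex (by omega)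
  refine ⟨n, hzero, Module.Basis.mk hli ?_, fun j ↦ by rw [Module.Basis.mk_apply]⟩
  rw [← hspan, Submodule.span_le]
  rintro _ ⟨j, rfl⟩
  rcases lt_or_ge n j with hj | hj
  · simp [hzero j hj]
  · exact Submodule.subset_span ⟨⟨j, by omega⟩, rfl⟩

end IsLadder

theorem repr_eq_zero_of_basis_eigenvectors {ι : Type*} {k : Module.End ℂ W}
    (e : Module.Basis ι ℂ W) {μ : ι → ℂ} (he : ∀ i, k (e i) = μ i • e i) {x : W}
    {a : ℂ} (ha : k x = a • x) {i : ι} (hi : a ≠ μ i) : e.repr x i = 0 := by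
  -- The coordinate functional is an eigenvector of the transpose of `k`, with eigenvalue `μ i`.
  have hcoord : (e.coord i) ∘ₗ k = μ i • e.coord i := by
    apply e.ext
    intro j
    rcases eq_or_ne j i with rfl | hj
    · simp [he]
    · simp [he, Finsupp.single_eq_of_ne' hj]
  have h := LinearMap.congr_fun hcoord x
  simp only [LinearMap.comp_apply, ha, map_smul, LinearMap.smul_apply, smul_eq_mul,
    Module.Basis.coord_apply] at h
  have : (a - μ i) * e.repr x i = 0 := by linear_combination h
  simpa [sub_ne_zero.2 hi] using this

/-- Eigenvalues of an operator that is diagonal in some basis. -/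
theorem exists_eq_of_basis_eigenvectors {ι : Type*} {k : Module.End ℂ W}
    (e : Module.Basis ι ℂ W) {μ : ι → ℂ} (he : ∀ i, k (e i) = μ i • e i) {x : W} (hx : x ≠ 0)
    {a : ℂ} (ha : k x = a • x) : ∃ i, a = μ i := by
  by_contra! hne
  apply hx
  apply e.repr.injective
  ext i
  simpa using repr_eq_zero_of_basis_eigenvectors e he ha (hne i)

/-! ### Structure and uniqueness of finite-dimensional irreducible representations -/

variable {τ : B q c₁ c₂ →ₐ[ℂ] Module.End ℂ W}

theorem B.map_sub (τ : B q c₁ c₂ →ₐ[ℂ] Module.End ℂ W) (x y : B q c₁ c₂) :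
    τ (x - y) = τ x - τ y := by
  have h : x - y + y = x := Subtype.ext (sub_add_cancel (x : Uq q) y)
  rw [eq_sub_iff_add_eq, ← map_add, h]

/-- A nonzero subspace stable under the generators is everything. -/
theorem IsIrreducible.eq_top (hτ : IsIrreducible τ) {S : Submodule ℂ W} (hS : S ≠ ⊥)
    (hK : ∀ x ∈ S, τ (B.K q c₁ c₂) x ∈ S) (hKinv : ∀ x ∈ S, τ (B.Kinv q c₁ c₂) x ∈ S)
    (h₁ : ∀ x ∈ S, τ (B.B₁ q c₁ c₂) x ∈ S) (h₂ : ∀ x ∈ S, τ (B.B₂ q c₁ c₂) x ∈ S) : S = ⊤ := by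
  have hstable (b : B q c₁ c₂) : ∀ x ∈ S, τ b x ∈ S := by
    induction b using B.induction with
    | hK => exact hK
    | hKinv => exact hKinv
    | h₁ => exact h₁
    | h₂ => exact h₂
    | halg r => intro x hx; simpa using S.smul_mem r hx
    | hadd a b ha hb => intro x hx; simpa using S.add_mem (ha x hx) (hb x hx)
    | hmul a b ha hb => intro x hx; simpa using ha _ (hb x hx)
  let S' : Subrepresentation (toRep τ) := ⟨S, fun b x hx ↦ hstable b x hx⟩
  rcases hτ.eq_bot_or_eq_top S' with h | h
  · exact absurd (congrArg Subrepresentation.toSubmodule h) hS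
  · exact congrArg Subrepresentation.toSubmodule h

theorem sq_sub_one_ne_zero (hq1 : ‖q‖ < 1) : q ^ 2 - 1 ≠ 0 := by
  intro h
  have h3 := congrArg norm (sub_eq_zero.1 h)
  rw [norm_pow, norm_one] at h3
  exact (pow_lt_one₀ (norm_nonneg q) hq1 two_ne_zero).ne h3

/-- A finite-dimensional irreducible representation has a highest weight vector that generates a
ladder. -/
theorem IsIrreducible.exists_ladder [FiniteDimensional ℂ W] (hτ : IsIrreducible τ)
    (hq : q ≠ 0) (hq1 : ‖q‖ < 1) :
    ∃ κ β : ℂ, ∃ w : ℕ → W, κ ≠ 0 ∧ IsHighestWeightVector τ κ (w 0) ∧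
      Submodule.span ℂ (Set.range w) = ⊤ ∧
      IsLadder (τ (B.K q c₁ c₂)) (τ (B.B₁ q c₁ c₂)) (τ (B.B₂ q c₁ c₂)) q κ
        (ladderCoeff q c₁ c₂ κ β) w := by
  have : Nontrivial W := by
    by_contra hW
    rw [not_nontrivial_iff_subsingleton] at hW
    obtain ⟨S, T, hST⟩ := hτ.exists_pair_ne
    apply hST
    apply Subrepresentation.toSubmodule_injective
    ext x
    simp [Subsingleton.elim x 0]
  set k := τ (B.K q c₁ c₂) with hk_def
  set k' := τ (B.Kinv q c₁ c₂) with hk'_def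
  set b₁ := τ (B.B₁ q c₁ c₂) with hb₁_def
  set b₂ := τ (B.B₂ q c₁ c₂) with hb₂_def
  have hk'k : k' * k = 1 := by rw [hk_def, hk'_def, ← map_mul, B.Kinv_mul_K, map_one]
  have hkb₁ : k * b₁ = (q ^ 3)⁻¹ • (b₁ * k) := by
    rw [hk_def, hb₁_def, ← map_mul, ← map_mul, ← map_smul, B.K_mul_B₁ hq]
  have hkb₂ : k * b₂ = q ^ 3 • (b₂ * k) := by
    rw [hk_def, hb₂_def, ← map_mul, ← map_mul, ← map_smul, B.K_mul_B₂ hq]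
  have hserre : b₂ * b₂ * b₁ - (q + q⁻¹) • (b₂ * b₁ * b₂) + b₁ * b₂ * b₂
      = (q + q⁻¹) • (b₂ * ((c₂ * q) • k + (c₁ * (q ^ 2)⁻¹) • k')) := by
    simpa [B.map_sub] using congrArg τ (B.serre_B₂ (c₁ := c₁) (c₂ := c₂) hq (sq_sub_one_ne_zero hq1))
  -- As `|q⁻³| > 1`, maximality of `|κ|` excludes `q⁻³κ` from the spectrum; this also makes `B₁`
  -- kill the whole `κ`-eigenspace.
  obtain ⟨κ, hκ_mem, hκ_max⟩ := Set.exists_max_image (spectrum ℂ k) (fun z ↦ ‖z‖)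
    (Module.End.finite_spectrum k) (by
      obtain ⟨c, hc⟩ := Module.End.exists_eigenvalue k
      exact ⟨c, hc.mem_spectrum⟩)
  have hκ : κ ≠ 0 := by
    rintro rfl
    rw [spectrum.zero_mem_iff] at hκ_mem
    apply hκ_mem
    have hkk' : k * k' = 1 := by rw [hk_def, hk'_def, ← map_mul, B.K_mul_Kinv, map_one]
    exact ⟨⟨k, k', hkk', hk'k⟩, rfl⟩
  have hnot : q ^ (-3 : ℤ) * κ ∉ spectrum ℂ k := by
    intro hmem
    have h := hκ_max _ hmem
    rw [norm_mul, norm_zpow] at h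
    have h1 : 1 < ‖q‖ ^ (-3 : ℤ) := one_lt_zpow_of_neg₀ (norm_pos_iff.2 hq) hq1 (by norm_num)
    have := norm_pos_iff.2 hκ
    nlinarith
  have hnot' (x : W) (hx : k x = (q ^ (-3 : ℤ) * κ) • x) : x = 0 := by
    by_contra hx0
    exact hnot (Module.End.hasEigenvalue_of_hasEigenvector
      ⟨Module.End.mem_eigenspace_iff.2 hx, hx0⟩).mem_spectrum
  set E := Module.End.eigenspace k κ
  have hE₁ (x : W) (hx : x ∈ E) : b₁ x = 0 := by
    apply hnot'
    have h := LinearMap.congr_fun hkb₁ x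
    simp only [Module.End.mul_apply, LinearMap.smul_apply, Module.End.mem_eigenspace_iff.1 hx,
      map_smul] at h
    rw [h, smul_smul]; congr 1
  have hE (x : W) (hx : x ∈ E) : (b₁ * b₂) x ∈ E := by
    rw [Module.End.mem_eigenspace_iff]
    have h := LinearMap.congr_fun hkb₁ (b₂ x)
    have h' := LinearMap.congr_fun hkb₂ x
    simp only [Module.End.mul_apply, LinearMap.smul_apply, Module.End.mem_eigenspace_iff.1 hx,
      map_smul] at h h'
    rw [Module.End.mul_apply, h, h', map_smul, map_smul, inv_smul_smul₀ (pow_ne_zero _ hq)]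
  have hEnt : Nontrivial E :=
    Submodule.nontrivial_iff_ne_bot.2 (Module.End.hasEigenvalue_iff_mem_spectrum.2 hκ_mem)
  -- `B₁B₂` commutes with `K`, so it has an eigenvector inside the `κ`-eigenspace.
  obtain ⟨β, hβ⟩ := Module.End.exists_eigenvalue ((b₁ * b₂).restrict hE)
  obtain ⟨⟨v, hvE⟩, hv⟩ := hβ.exists_hasEigenvector
  have hv0 : v ≠ 0 := fun h ↦ hv.2 (Subtype.ext h)
  have hvβ : b₁ (b₂ v) = β • v := congrArg Subtype.val hv.apply_eq_smul
  have hvk : k v = κ • v := Module.End.mem_eigenspace_iff.1 hvE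
  have hl := isLadder_pow hq hκ hk'k hkb₂ hserre hvk (hE₁ v hvE) hvβ
  refine ⟨κ, β, _, hκ, ⟨by simpa using hv0, by simpa using hE₁ v hvE, by simpa using hvk, hnot⟩,
    ?_, hl⟩
  have stable {f : Module.End ℂ W}
      (hf : ∀ j, f ((b₂ ^ j) v) ∈ Submodule.span ℂ (Set.range fun j ↦ (b₂ ^ j) v)) (x : W)
      (hx : x ∈ Submodule.span ℂ (Set.range fun j ↦ (b₂ ^ j) v)) :
      f x ∈ Submodule.span ℂ (Set.range fun j ↦ (b₂ ^ j) v) := by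
    refine (Submodule.span_le (p := Submodule.comap f
      (Submodule.span ℂ (Set.range fun j ↦ (b₂ ^ j) v)))).2 ?_ hx
    rintro _ ⟨j, rfl⟩
    exact hf j
  have mem (j : ℕ) : (b₂ ^ j) v ∈ Submodule.span ℂ (Set.range fun j ↦ (b₂ ^ j) v) :=
    Submodule.subset_span ⟨j, rfl⟩
  refine hτ.eq_top ?_ (stable fun j ↦ ?_) (stable fun j ↦ ?_) (stable fun j ↦ ?_)
    (stable fun j ↦ ?_)
  · intro h
    have := mem 0
    rw [h, Submodule.mem_bot] at this
    exact hv0 (by simpa using this)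
  · rw [← hk_def, hl.K_apply j]
    exact Submodule.smul_mem _ _ (mem j)
  · rw [← hk'_def, hl.K_inv_apply hq hκ hk'k j]
    exact Submodule.smul_mem _ _ (mem j)
  · rw [← hb₁_def]
    rcases j with _ | j
    · rw [hl.B₁_zero]
      exact Submodule.zero_mem _
    · rw [hl.B₁_succ j]
      exact Submodule.smul_mem _ _ (mem j)
  · rw [← hb₂_def, hl.B₂_apply j]
    exact mem _

/-- The action of `𝓑` on a ladder is by weight vectors. -/
theorem isWeightRep_of_isLadder {κ : ℂ} {b : ℕ → ℂ} {w : ℕ → W} (hq : q ≠ 0) (hκ : κ ≠ 0)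
    (h : IsLadder (τ (B.K q c₁ c₂)) (τ (B.B₁ q c₁ c₂)) (τ (B.B₂ q c₁ c₂)) q κ b w)
    (hspan : Submodule.span ℂ (Set.range w) = ⊤) : IsWeightRep τ := by
  have hk'k : τ (B.Kinv q c₁ c₂) * τ (B.K q c₁ c₂) = 1 := by
    rw [← map_mul, B.Kinv_mul_K, map_one]
  rw [IsWeightRep, eq_top_iff, ← hspan]
  apply Submodule.span_mono
  rintro _ ⟨j, rfl⟩ x hx
  have hK := h.K_apply j
  have hK' := h.K_inv_apply hq hκ hk'k j
  -- Both `B₁B₂` and `B₂B₁` act diagonally on the ladder, hence so do `C₁` and `C₂`.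
  have h₁₂ : τ (B.B₁ q c₁ c₂) (τ (B.B₂ q c₁ c₂) (w j)) = b (j + 1) • w j := by
    rw [h.B₂_apply, h.B₁_succ]
  obtain ⟨a, h₂₁⟩ : ∃ a : ℂ, τ (B.B₂ q c₁ c₂) (τ (B.B₁ q c₁ c₂) (w j)) = a • w j := by
    rcases j with _ | j
    · exact ⟨0, by rw [h.B₁_zero, map_zero, zero_smul]⟩
    · exact ⟨b (j + 1), by rw [h.B₁_succ, map_smul, h.B₂_apply]⟩
  induction hx using Algebra.adjoin_induction with
  | mem x hx =>
    rcases hx with rfl | rfl | rfl | rfl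
    · exact ⟨_, hK⟩
    · exact ⟨_, hK'⟩
    · simp only [B.C₁, map_add, B.map_sub, map_smul, map_mul, LinearMap.add_apply,
        LinearMap.sub_apply, LinearMap.smul_apply, Module.End.mul_apply, hK, hK', h₁₂, h₂₁,
        smul_smul, ← add_smul, ← sub_smul]
      exact ⟨_, rfl⟩
    · simp only [B.C₂, map_add, B.map_sub, map_smul, map_mul, LinearMap.add_apply,
        LinearMap.sub_apply, LinearMap.smul_apply, Module.End.mul_apply, hK, hK', h₁₂, h₂₁,
        smul_smul, ← add_smul, ← sub_smul]
      exact ⟨_, rfl⟩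
  | algebraMap r => exact ⟨r, by simp⟩
  | add x y _ _ hx hy =>
    obtain ⟨a, ha⟩ := hx
    obtain ⟨c, hc⟩ := hy
    exact ⟨a + c, by rw [map_add, LinearMap.add_apply, ha, hc, add_smul]⟩
  | mul x y _ _ hx hy =>
    obtain ⟨a, ha⟩ := hx
    obtain ⟨c, hc⟩ := hy
    exact ⟨c * a, by rw [map_mul, Module.End.mul_apply, hc, map_smul, ha, smul_smul]⟩

/-- Only the weight of the bottom of a ladder can be a highest weight. -/
theorem IsLadder.eq_of_isHighestWeight [FiniteDimensional ℂ W] {κ κ' : ℂ} {b : ℕ → ℂ} {w : ℕ → W}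
    (h : IsLadder (τ (B.K q c₁ c₂)) (τ (B.B₁ q c₁ c₂)) (τ (B.B₂ q c₁ c₂)) q κ b w)
    (hq : q ≠ 0) (hq1 : ‖q‖ < 1) (hκ : κ ≠ 0) (h0 : w 0 ≠ 0)
    (hspan : Submodule.span ℂ (Set.range w) = ⊤) (hκ' : IsHighestWeight τ κ') : κ' = κ := by
  obtain ⟨n, -, e, he⟩ := h.exists_basis hq hq1 hκ h0 hspan
  obtain ⟨x, hx⟩ := hκ'
  obtain ⟨⟨j, hj⟩, rfl⟩ := exists_eq_of_basis_eigenvectors e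
    (fun j ↦ by rw [he, h.K_apply]) hx.ne_zero hx.K_apply
  rcases j with _ | j
  · simp
  -- A highest weight equal to that of `w_{j+1}` is impossible: `w_j` has `q⁻³` times that weight.
  · refine absurd (Module.End.hasEigenvalue_of_hasEigenvector (x := w j)
      ⟨Module.End.mem_eigenspace_iff.2 ?_, ?_⟩).mem_spectrum hx.not_mem_spectrum
    · rw [h.K_apply, ← mul_assoc]
      congr 2
      rw [← zpow_natCast, ← zpow_natCast, ← zpow_add₀ hq]
      congr 1
      push_cast
      ring
    · rw [← he ⟨j, by omega⟩]
      exact e.ne_zero _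

/-- The highest weight and the dimension determine the representation. -/
theorem nonempty_equiv {W' : Type*} [AddCommGroup W'] [Module ℂ W'] [FiniteDimensional ℂ W]
    [FiniteDimensional ℂ W'] {τ' : B q c₁ c₂ →ₐ[ℂ] Module.End ℂ W'} (hq : q ≠ 0) (hq1 : ‖q‖ < 1)
    (hτ : IsIrreducible τ) (hτ' : IsIrreducible τ') {κ : ℂ} (hκ : IsHighestWeight τ κ)
    (hκ' : IsHighestWeight τ' κ) (hdim : Module.finrank ℂ W = Module.finrank ℂ W') :
    Nonempty ((toRep τ).Equiv (toRep τ')) := by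
  obtain ⟨μ, β, w, hμ, hw0, hspan, hw⟩ := hτ.exists_ladder hq hq1
  obtain ⟨μ', β', w', hμ', hw0', hspan', hw'⟩ := hτ'.exists_ladder hq hq1
  obtain rfl := hw.eq_of_isHighestWeight hq hq1 hμ hw0.ne_zero hspan hκ
  obtain rfl := hw'.eq_of_isHighestWeight hq hq1 hμ' hw0'.ne_zero hspan' hκ'
  obtain ⟨n, hn, e, he⟩ := hw.exists_basis hq hq1 hμ hw0.ne_zero hspan
  obtain ⟨n', hn', e', he'⟩ := hw'.exists_basis hq hq1 hμ hw0'.ne_zero hspan'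
  obtain rfl : n = n' := by
    rw [Module.finrank_eq_card_basis e, Module.finrank_eq_card_basis e'] at hdim
    simpa using hdim
  -- Both sequences vanish at `n + 1`, so `[n+1]_q (β - β') = 0`.
  have hβ : β = β' := by
    have hb := hw.coeff_eq_zero (by simpa [he] using e.ne_zero (Fin.last n)) (hn _ n.lt_succ_self)
    have hb' := hw'.coeff_eq_zero (by simpa [he'] using e'.ne_zero (Fin.last n))
      (hn' _ n.lt_succ_self)
    have h := ladderCoeff_sub (c₁ := c₁) (c₂ := c₂) (κ := κ) hq (sq_sub_one_ne_zero hq1) β β'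
      (n + 1)
    rw [hb, hb', sub_zero, eq_comm, mul_eq_zero] at h
    exact sub_eq_zero.1 (h.resolve_left (qNumber_ne_zero hq hq1 n.succ_ne_zero))
  subst hβ
  let φ : W ≃ₗ[ℂ] W' := e.equiv e' (Equiv.refl _)
  have hφ (j : ℕ) : φ (w j) = w' j := by
    rcases lt_or_ge n j with hj | hj
    · rw [hn j hj, hn' j hj, map_zero]
    · have := e.equiv_apply ⟨j, by omega⟩ e' (Equiv.refl _)
      rwa [he, Equiv.refl_apply, he'] at this
  have hk'k : τ (B.Kinv q c₁ c₂) * τ (B.K q c₁ c₂) = 1 := by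
    rw [← map_mul, B.Kinv_mul_K, map_one]
  have hk'k' : τ' (B.Kinv q c₁ c₂) * τ' (B.K q c₁ c₂) = 1 := by
    rw [← map_mul, B.Kinv_mul_K, map_one]
  have ext_ladder {f : Module.End ℂ W} {f' : Module.End ℂ W'}
      (hf : ∀ j, φ (f (w j)) = f' (w' j)) (x : W) : φ (f x) = f' (φ x) := by
    have h : φ.toLinearMap ∘ₗ f = f' ∘ₗ φ.toLinearMap := e.ext fun j ↦ by simp [he, hf, hφ]
    exact LinearMap.congr_fun h x
  refine ⟨Representation.Equiv.mk φ fun b ↦ LinearMap.ext ?_⟩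
  change ∀ x, φ (τ b x) = τ' b (φ x)
  induction b using B.induction with
  | hK => exact ext_ladder fun j ↦ by rw [hw.K_apply, hw'.K_apply, map_smul, hφ]
  | hKinv =>
    exact ext_ladder fun j ↦ by
      rw [hw.K_inv_apply hq hμ hk'k, hw'.K_inv_apply hq hμ hk'k', map_smul, hφ]
  | h₁ =>
    refine ext_ladder fun j ↦ ?_
    rcases j with _ | j
    · rw [hw.B₁_zero, hw'.B₁_zero, map_zero]
    · rw [hw.B₁_succ, hw'.B₁_succ, map_smul, hφ]
  | h₂ => exact ext_ladder fun j ↦ by rw [hw.B₂_apply, hw'.B₂_apply, hφ]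
  | halg r => intro x; simp
  | hadd a b ha hb => intro x; simp [ha, hb]
  | hmul a b ha hb => intro x; simp [ha, hb]

/-! ### A `q`-oscillator module of `U_q(su(3))` -/

/-- The space spanned (formally) by monomials `x₁^{s-m-k} x₂^m x₃^k`, `m, k ∈ ℤ`. -/
abbrev Osc : Type := ℤ → ℤ → ℂ

/-- The operator `f ↦ c(q^m, q^k) f(m + a, k + b)`. -/
def Osc.shift (q : ℂ) (c : ℂ → ℂ → ℂ) (a b : ℤ) : Module.End ℂ Osc where
  toFun f m k := c (q ^ m) (q ^ k) * f (m + a) (k + b)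
  map_add' f g := by ext; simp [mul_add]
  map_smul' r f := by ext; simp [mul_left_comm]

@[simp]
theorem Osc.shift_apply (q : ℂ) (c : ℂ → ℂ → ℂ) (a b : ℤ) (f : Osc) (m k : ℤ) :
    Osc.shift q c a b f m k = c (q ^ m) (q ^ k) * f (m + a) (k + b) := rfl

/-- The `q`-bracket `(z - z⁻¹) / (q - q⁻¹)`. -/
def qBracket (q z : ℂ) : ℂ := (z - z⁻¹) * (q - q⁻¹)⁻¹

/-- The action of the generators of `U_q(su(3))`, where `t` plays the role of `q^s`. -/
def Osc.gen (q t : ℂ) : Gen → Module.End ℂ Osc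
  -- Reading `f` as coefficients of the monomials, `E₁, F₁, E₂, F₂` are `q`-analogues of `x₂∂₁,
  -- x₁∂₂, x₃∂₂, x₂∂₃`; the shifts act on coefficients, which explains the `+1` in each bracket.
  | Gen.E 0 => Osc.shift q (fun x y ↦ qBracket q (t * q * x⁻¹ * y⁻¹)) (-1) 0
  | Gen.E 1 => Osc.shift q (fun x _ ↦ qBracket q (q * x)) 1 (-1)
  | Gen.F 0 => Osc.shift q (fun x _ ↦ qBracket q (q * x)) 1 0
  | Gen.F 1 => Osc.shift q (fun _ y ↦ qBracket q (q * y)) (-1) 1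
  | Gen.K 0 => Osc.shift q (fun x y ↦ x ^ 2 * y * t⁻¹) 0 0
  | Gen.K 1 => Osc.shift q (fun x y ↦ y * x⁻¹) 0 0
  | Gen.Kinv 0 => Osc.shift q (fun x y ↦ (x ^ 2 * y * t⁻¹)⁻¹) 0 0
  | Gen.Kinv 1 => Osc.shift q (fun x y ↦ (y * x⁻¹)⁻¹) 0 0

theorem Osc.rel {q t : ℂ} (hq : q ≠ 0) (hq2 : q ^ 2 - 1 ≠ 0) (ht : t ≠ 0) ⦃x y : Free⦄
    (h : Rel q x y) :
    FreeAlgebra.lift ℂ (Osc.gen q t) x = FreeAlgebra.lift ℂ (Osc.gen q t) y := by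
  obtain ⟨h00, h01, h10, h11⟩ := cartan_A_two
  cases h
  case E_F_same i =>
    fin_cases i
    all_goals
      ext f m k
      have hx := zpow_ne_zero m hq
      have hy := zpow_ne_zero k hq
      simp [Osc.gen, add_assoc, zpow_add₀ hq, qBracket]
      generalize q ^ m = x at *
      generalize q ^ k = y at *
      field_simp
      ring
  case K_mul_Kinv i | Kinv_mul_K i =>
    fin_cases i
    all_goals
      ext f m k
      have hx := zpow_ne_zero m hq
      have hy := zpow_ne_zero k hq
      simp [Osc.gen]
      field_simp
  case serre_E i j h | serre_F i j h | E_F_ne i j h =>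
    fin_cases i <;> fin_cases j <;> first | exact absurd rfl h | skip
    all_goals
      ext f m k
      have hx := zpow_ne_zero m hq
      have hy := zpow_ne_zero k hq
      simp [Osc.gen, add_assoc, zpow_add₀ hq, pow_two, qBracket]
      try generalize q ^ m = x at *
      try generalize q ^ k = y at *
      try generalize (q - q⁻¹)⁻¹ = s at *
      try field_simp
      try ring
  all_goals
    rename_i i j
    fin_cases i <;> fin_cases j <;>
    · ext f m k
      have hx := zpow_ne_zero m hq
      have hy := zpow_ne_zero k hq
      simp [Osc.gen, h00, h01, h10, h11, zpow_add₀ hq]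
      try field_simp

/-- The oscillator representation of `U_q(su(3))`. -/
def Osc.rep {q t : ℂ} (hq : q ≠ 0) (hq2 : q ^ 2 - 1 ≠ 0) (ht : t ≠ 0) : Uq q →ₐ[ℂ] Module.End ℂ Osc :=
  RingQuot.liftAlgHom ℂ ⟨FreeAlgebra.lift ℂ (Osc.gen q t), Osc.rel hq hq2 ht⟩

namespace Osc

variable {q t : ℂ} (hq : q ≠ 0) (hq2 : q ^ 2 - 1 ≠ 0) (ht : t ≠ 0)

theorem rep_mk (g : Gen) :
    Osc.rep hq hq2 ht (Uq.mk q (FreeAlgebra.ι ℂ g)) = Osc.gen q t g := by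
  simp [Osc.rep]

theorem rep_uK (f : Osc) (m k : ℤ) :
    Osc.rep hq hq2 ht (uK q) f m k = (q ^ m) ^ 3 * t⁻¹ * f m k := by
  have hx := zpow_ne_zero m hq
  have hy := zpow_ne_zero k hq
  simp only [uK, Uq.K, Uq.Kinv, map_mul, rep_mk, gen, Module.End.mul_apply, shift_apply, add_zero]
  field_simp

theorem map_sub_Uq (ρ : Uq q →ₐ[ℂ] Module.End ℂ Osc) (x y : Uq q) : ρ (x - y) = ρ x - ρ y := by
  rw [eq_sub_iff_add_eq, ← map_add, sub_add_cancel]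

theorem rep_uB₁ (c₁ : ℂ) (f : Osc) (m k : ℤ) :
    Osc.rep hq hq2 ht (uB₁ q c₁) f m k = qBracket q (q * q ^ m) *
      (f (m + 1) k - c₁ * t * q⁻¹ * (q ^ m)⁻¹ ^ 2 * (q ^ k)⁻¹ * f (m + 1) (k - 1)) := by
  have hx := zpow_ne_zero m hq
  have hy := zpow_ne_zero k hq
  simp only [uB₁, Uq.E, Uq.F, Uq.Kinv, map_sub_Uq, map_smul, map_mul, rep_mk, gen,
    Module.End.mul_apply, LinearMap.sub_apply, LinearMap.smul_apply, Pi.sub_apply, Pi.smul_apply,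
    smul_eq_mul, shift_apply, add_zero, zpow_sub_one₀ hq, zpow_add_one₀ hq, ← sub_eq_add_neg]
  field_simp

theorem rep_uB₂ (c₂ : ℂ) (f : Osc) (m k : ℤ) :
    Osc.rep hq hq2 ht (uB₂ q c₂) f m k = qBracket q (q * q ^ k) * f (m - 1) (k + 1) -
      c₂ * qBracket q (t * q * (q ^ m)⁻¹ * (q ^ k)⁻¹) * q⁻¹ * (q ^ k)⁻¹ * q ^ m *
        f (m - 1) k := by
  have hx := zpow_ne_zero m hq
  have hy := zpow_ne_zero k hq
  simp only [uB₂, Uq.E, Uq.F, Uq.Kinv, map_sub_Uq, map_smul, map_mul, rep_mk, gen,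
    Module.End.mul_apply, LinearMap.sub_apply, LinearMap.smul_apply, Pi.sub_apply, Pi.smul_apply,
    smul_eq_mul, shift_apply, add_zero, zpow_sub_one₀ hq, ← sub_eq_add_neg]
  field_simp

end Osc

/-! ### Ladders in the oscillator module -/

/-- Solutions of a two-term recursion on `ℤ` supported on the nonnegative integers. -/
theorem exists_recursion (A C : ℤ → ℂ) :
    ∃ g : ℤ → ℂ, g 0 = 1 ∧ (∀ k < 0, g k = 0) ∧
      ∀ k, 0 ≤ k → g (k + 1) = A k * g k + C k * g (k - 1) := by
  let p : ℕ → ℂ × ℂ := fun n ↦ Nat.rec (1, 0) (fun n x ↦ (A n * x.1 + C n * x.2, x.1)) n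
  refine ⟨fun k ↦ if k < 0 then 0 else (p k.toNat).1, rfl, fun k hk ↦ if_pos hk, fun k hk ↦ ?_⟩
  lift k to ℕ using hk
  rcases k with _ | k
  · simp [p]
  · have h1 : ((k + 1 : ℕ) : ℤ) + 1 = ((k + 2 : ℕ) : ℤ) := by push_cast; ring
    have h2 : ((k + 1 : ℕ) : ℤ) - 1 = (k : ℤ) := by push_cast; ring
    simp only [h1, h2, Int.toNat_natCast, (Int.natCast_nonneg _).not_gt, if_false]
    rfl

theorem qBracket_zpow_ne_zero {q : ℂ} (hq : q ≠ 0) (hq1 : ‖q‖ < 1) {j : ℤ} (hj : 0 < j) :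
    qBracket q (q ^ j) ≠ 0 := by
  lift j to ℕ using hj.le
  have := qNumber_ne_zero hq hq1 (j := j) (by omega)
  simpa [qBracket, qNumber, div_eq_mul_inv] using this

/-- The closed form solves the ladder recursion; being zero at `n + 1`, it is the solution that
truncates there. -/
theorem bCoeff_eq_ladderCoeff {q c₁ c₂ κ : ℂ} (hq : q ≠ 0) (hq2 : q ^ 2 - 1 ≠ 0) (hκ : κ ≠ 0)
    (hc₁ : c₁ ≠ 0) (n j : ℕ) :
    bCoeff q c₁ c₂ κ n j = ladderCoeff q c₁ c₂ κ (bCoeff q c₁ c₂ κ n 1) j := by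
  induction j using Nat.twoStepInduction with
  | zero => simp [ladderCoeff, bCoeff, qNumber]
  | one => simp [ladderCoeff]
  | more j h₀ h₁ =>
    rw [ladderCoeff, ← h₀, ← h₁]
    have hx : q ^ j ≠ 0 := pow_ne_zero _ hq
    have hy : q ^ n ≠ 0 := pow_ne_zero _ hq
    have hd : q - q⁻¹ ≠ 0 := by
      intro h; apply hq2; field_simp at h; linear_combination h
    simp only [bCoeff, qNumber, zpow_add₀ hq, zpow_sub₀ hq, zpow_mul, Nat.cast_add, mul_add,
      zpow_natCast, pow_add, pow_mul, Nat.cast_ofNat, zpow_ofNat, zpow_neg, Nat.cast_one,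
      neg_mul, mul_one, pow_right_comm q 2, pow_right_comm q 3]
    generalize q ^ j = x at *
    generalize q ^ n = y at *
    field_simp
    ring

/-- There is a vector of weight `t⁻¹` in the oscillator module that is annihilated by `B₁`, on which
`B₁ B₂` acts by a prescribed scalar, and that is supported on `m = 0`, `k ≥ 0`. -/
theorem Osc.exists_vector {q t : ℂ} (hq : q ≠ 0) (hq1 : ‖q‖ < 1) (hq2 : q ^ 2 - 1 ≠ 0)
    (ht : t ≠ 0) (c₁ c₂ β : ℂ) :
    ∃ v : Osc, v ≠ 0 ∧ (∀ m k, k < 0 → v m k = 0) ∧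
      Osc.rep hq hq2 ht (uK q) v = t⁻¹ • v ∧ Osc.rep hq hq2 ht (uB₁ q c₁) v = 0 ∧
      Osc.rep hq hq2 ht (uB₁ q c₁) (Osc.rep hq hq2 ht (uB₂ q c₂) v) = β • v := by
  have hbr (y : ℂ) : qBracket q (q * y) = (q * y - (q * y)⁻¹) * (q - q⁻¹)⁻¹ := rfl
  have hd : q - q⁻¹ ≠ 0 := by
    intro h; apply hq2; field_simp at h; linear_combination h
  -- On the row `m = 0`, `B₁B₂ v = β v` is a three-term recursion in `k` with leading coefficient
  -- `[k+1]_q`, nonzero for `k ≥ 0`.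
  obtain ⟨g, hg0, hgneg, hg⟩ := exists_recursion
    (fun k ↦ (c₂ * qBracket q (t * (q ^ k)⁻¹) * (q ^ k)⁻¹ +
      c₁ * t * q⁻¹ * (q ^ k)⁻¹ * qBracket q (q ^ k) + β) / qBracket q (q * q ^ k))
    (fun k ↦ -(c₁ * t * (q ^ k)⁻¹ ^ 2 * c₂ * qBracket q (t * q * (q ^ k)⁻¹)) /
      qBracket q (q * q ^ k))
  have hg' (k : ℤ) : qBracket q (q * q ^ k) * g (k + 1) =
      (c₂ * qBracket q (t * (q ^ k)⁻¹) * (q ^ k)⁻¹ +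
        c₁ * t * q⁻¹ * (q ^ k)⁻¹ * qBracket q (q ^ k) + β) * g k -
      c₁ * t * (q ^ k)⁻¹ ^ 2 * c₂ * qBracket q (t * q * (q ^ k)⁻¹) * g (k - 1) := by
    rcases lt_trichotomy k (-1) with hk | rfl | hk
    · rw [hgneg _ (by omega), hgneg _ (by omega), hgneg _ (by omega)]; ring
    -- At `k = -1` the leading coefficient is `[0]_q = 0`, so `g 0 = 1` is compatible with vanishing
    -- at negative indices.
    · rw [hgneg (-1) (by omega), hgneg (-1 - 1) (by omega)]
      simp [qBracket, hq]
    · have hne : qBracket q (q * q ^ k) ≠ 0 := by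
        rw [mul_comm, ← zpow_add_one₀ hq]
        exact qBracket_zpow_ne_zero hq hq1 (by omega)
      rw [hg k (by omega)]
      field_simp
      ring
  refine ⟨fun m k ↦ if m = 0 then g k else 0, ?_, ?_, ?_, ?_, ?_⟩
  · intro h
    simpa [hg0] using congrFun (congrFun h 0) 0
  · intro m k hk
    simp [hgneg k hk]
  · ext m k
    rcases eq_or_ne m 0 with rfl | hm <;> simp [rep_uK, *]
  · ext m k
    rcases eq_or_ne (m + 1) 0 with hm | hm
    · obtain rfl : m = -1 := by omega
      simp [rep_uB₁, qBracket, hq]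
    · simp [rep_uB₁, hm]
  · ext m k
    rcases eq_or_ne m 0 with rfl | hm
    · have h1 : qBracket q q = 1 := mul_inv_cancel₀ hd
      have hy := zpow_ne_zero k hq
      have e1 : q * (q ^ k * q⁻¹) = q ^ k := by field_simp
      have e2 : t * q * q⁻¹ * (q ^ k)⁻¹ = t * (q ^ k)⁻¹ := by field_simp
      have e3 : t * q * q⁻¹ * (q ^ k * q⁻¹)⁻¹ = t * q * (q ^ k)⁻¹ := by field_simp
      simp [rep_uB₁, rep_uB₂, h1, zpow_sub_one₀ hq, hg', -mul_inv_rev, e1, e2, e3]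
      field_simp
      ring
    · simp [rep_uB₁, rep_uB₂, hm]

theorem Osc.isLadder_eq_zero {q t : ℂ} (hq : q ≠ 0) (hq1 : ‖q‖ < 1) (hq2 : q ^ 2 - 1 ≠ 0)
    (ht : t ≠ 0) {c₁ c₂ : ℂ} {b : ℕ → ℂ} {w : ℕ → Osc}
    (h : IsLadder (Osc.rep hq hq2 ht (uK q)) (Osc.rep hq hq2 ht (uB₁ q c₁))
      (Osc.rep hq hq2 ht (uB₂ q c₂)) q t⁻¹ b w)
    (h0 : ∀ m k, k < 0 → w 0 m k = 0) {n : ℕ} (hn : b (n + 1) = 0) : w (n + 1) = 0 := by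
  have hsupp (j : ℕ) : ∀ m k, k < 0 → w j m k = 0 := by
    induction j with
    | zero => exact h0
    | succ j ih =>
      intro m k hk
      rw [← h.B₂_apply, rep_uB₂, ih _ k hk]
      rcases eq_or_ne k (-1) with rfl | hk'
      · simp [qBracket, hq]
      · rw [ih _ (k + 1) (by omega)]; simp
  -- The `K`-weight determines the row, so `w (n + 1)` lives on `m = n + 1`. There `B₁ w_{n+1} = 0`
  -- is a first-order recursion in `k`, and vanishing for `k < 0` propagates upwards.
  have hlevel (m k : ℤ) (hm : m ≠ n + 1) : w (n + 1) m k = 0 := by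
    have hK := congrFun (congrFun (h.K_apply (n + 1)) m) k
    rw [rep_uK, Pi.smul_apply, Pi.smul_apply, smul_eq_mul] at hK
    by_contra hne
    have hK' := congrArg norm (mul_right_cancel₀ (inv_ne_zero ht) (mul_right_cancel₀ hne hK))
    rw [pow_mul', ← zpow_natCast q (n + 1), norm_pow, norm_pow, norm_zpow, norm_zpow] at hK'
    have hK'' := (pow_left_inj₀ (by positivity) (by positivity) three_ne_zero).1 hK'
    exact hm (by simpa using (zpow_right_inj₀ (norm_pos_iff.2 hq) hq1.ne).1 hK'')
  have hB₁ := h.B₁_succ n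
  rw [hn, zero_smul] at hB₁
  have hstep (k : ℤ) : w (n + 1) (n + 1) k =
      c₁ * t * q⁻¹ * (q ^ (n : ℤ))⁻¹ ^ 2 * (q ^ k)⁻¹ * w (n + 1) (n + 1) (k - 1) := by
    have hk := congrFun (congrFun hB₁ n) k
    rw [rep_uB₁, Pi.zero_apply, Pi.zero_apply, mul_eq_zero] at hk
    refine sub_eq_zero.1 (hk.resolve_left ?_)
    rw [mul_comm, ← zpow_add_one₀ hq]
    exact qBracket_zpow_ne_zero hq hq1 (by omega)
  have hall (k : ℕ) : w (n + 1) (n + 1) k = 0 := by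
    induction k with
    | zero => rw [hstep, hsupp _ _ _ (by simp), mul_zero]
    | succ k ih => rw [hstep]; push_cast; rw [add_sub_cancel_right, ih, mul_zero]
  ext m k
  rcases eq_or_ne m (n + 1) with rfl | hm
  · rcases lt_or_ge k 0 with hk | hk
    · exact hsupp _ _ _ hk
    · lift k to ℕ using hk
      exact hall k
  · exact hlevel m k hm

/-! ### Restriction to `𝓑`, irreducibility and existence -/

/-- Restriction of a representation of `U_q(su(3))` to a `𝓑`-stable subspace. -/
theorem exists_restrict {q c₁ c₂ : ℂ} {V M : Type*} [AddCommGroup V] [Module ℂ V]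
    [AddCommGroup M] [Module ℂ M] (ρ : Uq q →ₐ[ℂ] Module.End ℂ M) (ι : V →ₗ[ℂ] M)
    (hι : Function.Injective ι) (hK : ∀ x, ρ (uK q) (ι x) ∈ LinearMap.range ι)
    (hKinv : ∀ x, ρ (uKinv q) (ι x) ∈ LinearMap.range ι)
    (h₁ : ∀ x, ρ (uB₁ q c₁) (ι x) ∈ LinearMap.range ι)
    (h₂ : ∀ x, ρ (uB₂ q c₂) (ι x) ∈ LinearMap.range ι) :
    ∃ τ : B q c₁ c₂ →ₐ[ℂ] Module.End ℂ V, ∀ b x, ι (τ b x) = ρ b (ι x) := by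
  have hmem (b : B q c₁ c₂) : ∀ x, ρ b (ι x) ∈ LinearMap.range ι := by
    induction b using B.induction with
    | hK => exact hK
    | hKinv => exact hKinv
    | h₁ => exact h₁
    | h₂ => exact h₂
    | halg r => exact fun x ↦ ⟨r • x, by simp⟩
    | hadd a b ha hb => intro x; simpa using Submodule.add_mem _ (ha x) (hb x)
    | hmul a b ha hb =>
      intro x
      obtain ⟨y, hy⟩ := hb x
      simpa [hy] using ha y
  have hex (b : B q c₁ c₂) : ∃ T : Module.End ℂ V, ∀ x, ι (T x) = ρ b (ι x) := by
    refine ⟨(LinearEquiv.ofInjective ι hι).symm.toLinearMap ∘ₗ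
      LinearMap.codRestrict (LinearMap.range ι) (ρ b ∘ₗ ι) (hmem b), fun x ↦ ?_⟩
    have h := (LinearEquiv.ofInjective ι hι).apply_symm_apply ⟨ρ b (ι x), hmem b x⟩
    exact congrArg Subtype.val h
  choose T hT using hex
  refine ⟨{ toFun := T, map_one' := ?_, map_mul' := ?_, map_zero' := ?_, map_add' := ?_,
            commutes' := ?_ }, hT⟩
  · ext x; apply hι; simp [hT]
  · intro a b; ext x; apply hι; simp [hT]
  · ext x; apply hι; simp [hT]
  · intro a b; ext x; apply hι; simp [hT]
  · intro r; ext x; apply hι; simp [hT]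

theorem bCoeff_succ_self (q c₁ c₂ κ : ℂ) (n : ℕ) : bCoeff q c₁ c₂ κ n (n + 1) = 0 := by
  have : 2 * (n : ℤ) - 2 * ((n + 1 : ℕ) : ℤ) + 2 = 0 := by push_cast; ring
  rw [bCoeff, this, zpow_zero, sub_self, zero_mul, zero_div, mul_zero]

theorem bCoeff_ne_zero {q c₁ c₂ κ : ℂ} (hq : q ≠ 0) (hq1 : ‖q‖ < 1) (hκ : κ ≠ 0) (hc₁ : c₁ ≠ 0)
    (hc₂ : c₂ ≠ 0) (hκ' : ∀ m : ℕ, κ ^ 2 ≠ -c₁ * c₂⁻¹ * q ^ (1 - (m : ℤ))) {n j : ℕ}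
    (hj : 0 < j) (hjn : j ≤ n) : bCoeff q c₁ c₂ κ n j ≠ 0 := by
  have hd : q - q⁻¹ ≠ 0 := by
    intro h
    apply sq_sub_one_ne_zero hq1
    field_simp at h
    linear_combination h
  refine mul_ne_zero (mul_ne_zero (mul_ne_zero (mul_ne_zero hc₁ (inv_ne_zero hκ))
    (zpow_ne_zero _ hq)) (qNumber_ne_zero hq hq1 hj.ne')) (div_ne_zero (mul_ne_zero ?_ ?_) hd)
  · intro h
    have h1 := congrArg norm (sub_eq_zero.1 h)
    rw [norm_one, norm_zpow] at h1
    exact (zpow_lt_one₀ (norm_pos_iff.2 hq) hq1 (n := 2 * (n : ℤ) - 2 * j + 2) (by omega)).ne h1.symm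
  · intro h
    -- The last factor vanishes exactly when `κ² = -c₁c₂⁻¹q^{1-m}` for this `m`.
    apply hκ' (2 * j + 2 * n)
    have he : q ^ (2 * (j : ℤ) + 2 * n - 1) ≠ 0 := zpow_ne_zero _ hq
    have e : (1 - ((2 * j + 2 * n : ℕ) : ℤ)) = -(2 * (j : ℤ) + 2 * n - 1) := by push_cast; ring
    rw [e, zpow_neg]
    field_simp at h ⊢
    linear_combination h

/-- A criterion for irreducibility in terms of a basis of weight vectors. -/
theorem isIrreducible_of_basis {q c₁ c₂ : ℂ} {W : Type*} [AddCommGroup W] [Module ℂ W]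
    {τ : B q c₁ c₂ →ₐ[ℂ] Module.End ℂ W} {n : ℕ} (e : Module.Basis (Fin (n + 1)) ℂ W)
    {μ : Fin (n + 1) → ℂ} (hμ : Function.Injective μ)
    (hK : ∀ j, τ (B.K q c₁ c₂) (e j) = μ j • e j)
    (h₂ : ∀ j : Fin n, τ (B.B₂ q c₁ c₂) (e j.castSucc) = e j.succ)
    {b : Fin n → ℂ} (hb : ∀ j, b j ≠ 0)
    (h₁ : ∀ j : Fin n, τ (B.B₁ q c₁ c₂) (e j.succ) = b j • e j.castSucc) :
    IsIrreducible τ := by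
  have : FiniteDimensional ℂ W := .of_basis e
  refine { exists_pair_ne := ⟨⊥, ⊤, fun h ↦ ?_⟩, eq_bot_or_eq_top := fun S ↦ ?_ }
  · have h' : (⊥ : Submodule ℂ W) = ⊤ := congrArg Subrepresentation.toSubmodule h
    have : e 0 ∈ (⊥ : Submodule ℂ W) := h' ▸ Submodule.mem_top
    exact e.ne_zero 0 this
  refine or_iff_not_imp_left.2 fun hS ↦ Subrepresentation.toSubmodule_injective ?_
  change S.toSubmodule = ⊤
  have hS' : S.toSubmodule ≠ ⊥ := fun h ↦ hS (Subrepresentation.toSubmodule_injective h)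
  have stable (a : B q c₁ c₂) {x : W} (hx : x ∈ S.toSubmodule) : τ a x ∈ S.toSubmodule :=
    S.apply_mem_toSubmodule a hx
  have : Nontrivial S.toSubmodule := Submodule.nontrivial_iff_ne_bot.2 hS'
  obtain ⟨a, ha⟩ := Module.End.exists_eigenvalue
    ((τ (B.K q c₁ c₂)).restrict (p := S.toSubmodule) (q := S.toSubmodule) fun x hx ↦ stable _ hx)
  obtain ⟨⟨x, hxS⟩, hx⟩ := ha.exists_hasEigenvector
  have hx0 : x ≠ 0 := fun h ↦ hx.2 (Subtype.ext h)
  have hxa : τ (B.K q c₁ c₂) x = a • x := congrArg Subtype.val hx.apply_eq_smul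
  obtain ⟨i, rfl⟩ := exists_eq_of_basis_eigenvectors e hK hx0 hxa
  -- Distinct weights make an eigenvector of `K` a multiple of one `e i`. Then `B₁` descends to `e
  -- 0`, the `b j` being nonzero, and `B₂` climbs to the rest.
  have hx_eq : e.repr x i • e i = x := by
    have h := Fintype.sum_eq_single (f := fun j ↦ e.repr x j • e j) i fun j hj ↦ by
      rw [repr_eq_zero_of_basis_eigenvectors e hK hxa (hμ.ne hj.symm), zero_smul]
    rw [← h, e.sum_repr]
  have hei : e i ∈ S.toSubmodule := by
    have hne : e.repr x i ≠ 0 := fun h ↦ hx0 (by rw [← hx_eq, h, zero_smul])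
    rw [← hx_eq] at hxS
    exact (Submodule.smul_mem_iff _ hne).1 hxS
  have down (j : Fin (n + 1)) : e j ∈ S.toSubmodule → e 0 ∈ S.toSubmodule := by
    induction j using Fin.induction with
    | zero => exact id
    | succ j ih =>
      intro hj
      have h := stable (B.B₁ q c₁ c₂) hj
      rw [h₁, Submodule.smul_mem_iff _ (hb j)] at h
      exact ih h
  rw [eq_top_iff, ← e.span_eq, Submodule.span_le]
  rintro _ ⟨j, rfl⟩
  induction j using Fin.induction with
  | zero => exact down i hei
  | succ j ih => exact h₂ j ▸ stable _ ih

/-- The representation with highest weight `κ` and dimension `n + 1`. -/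
theorem exists_rep {q c₁ c₂ κ : ℂ} (hq : q ≠ 0) (hq1 : ‖q‖ < 1) (hc₁ : c₁ ≠ 0) (hc₂ : c₂ ≠ 0)
    (hκ : κ ≠ 0) (n : ℕ) (hκ' : ∀ m : ℕ, κ ^ 2 ≠ -c₁ * c₂⁻¹ * q ^ (1 - (m : ℤ))) :
    ∃ (τ : B q c₁ c₂ →ₐ[ℂ] Module.End ℂ (Fin (n + 1) → ℂ))
      (w : Module.Basis (Fin (n + 1)) ℂ (Fin (n + 1) → ℂ)),
      IsIrreducible τ ∧ IsHighestWeightVector τ κ (w 0) ∧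
      (∀ j : Fin (n + 1), τ (B.K q c₁ c₂) (w j) = (q ^ (3 * (j : ℕ)) * κ) • w j) ∧
      (∀ j : Fin n, τ (B.B₂ q c₁ c₂) (w j.castSucc) = w j.succ) ∧
      τ (B.B₂ q c₁ c₂) (w (Fin.last n)) = 0 ∧
      τ (B.B₁ q c₁ c₂) (w 0) = 0 ∧
      (∀ j : Fin n, τ (B.B₁ q c₁ c₂) (w j.succ) =
        bCoeff q c₁ c₂ κ n ((j : ℕ) + 1) • w j.castSucc) := by
  have hq2 := sq_sub_one_ne_zero hq1
  have ht : κ⁻¹ ≠ 0 := inv_ne_zero hκ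
  -- The parameter is `t = κ⁻¹`, so that the vector has weight `t⁻¹ = κ`.
  obtain ⟨v, hv0, hvsupp, hvK, hv₁, hv₂⟩ :=
    Osc.exists_vector hq hq1 hq2 ht c₁ c₂ (bCoeff q c₁ c₂ κ n 1)
  set ρ := Osc.rep hq hq2 ht with hρ
  have hk'k : ρ (uKinv q) * ρ (uK q) = 1 := by rw [← map_mul, uKinv_mul_uK, map_one]
  have hl := isLadder_pow (c₁ := c₁) (c₂ := c₂) hq (inv_ne_zero ht) hk'k
    (by rw [← map_mul, ← map_mul, ← map_smul, (uK_mul_uB c₁ c₂ hq).2])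
    (by simpa [Osc.map_sub_Uq] using congrArg ρ (uB₂_serre c₁ c₂ hq hq2)) hvK hv₁ hv₂
  set w : ℕ → Osc := fun j ↦ (ρ (uB₂ q c₂) ^ j) v with hw
  have hlast : w (n + 1) = 0 := by
    refine Osc.isLadder_eq_zero hq hq1 hq2 ht hl (by simpa [hw] using hvsupp) ?_
    rw [inv_inv, ← bCoeff_eq_ladderCoeff hq hq2 hκ hc₁, bCoeff_succ_self]
  rw [inv_inv] at hl
  have hB₁ (j : ℕ) : ρ (uB₁ q c₁) (w (j + 1)) = bCoeff q c₁ c₂ κ n (j + 1) • w j := by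
    rw [hl.B₁_succ, ← bCoeff_eq_ladderCoeff hq hq2 hκ hc₁]
  have hw0 (j : ℕ) (hj : j ≤ n) : w j ≠ 0 := by
    induction j with
    | zero => simpa [hw] using hv0
    | succ j ih =>
      intro h
      have h' := hB₁ j
      rw [h, map_zero, eq_comm, smul_eq_zero] at h'
      exact h'.elim (bCoeff_ne_zero hq hq1 hκ hc₁ hc₂ hκ' j.succ_pos hj) (ih (by omega))
  have hli : LinearIndependent ℂ (fun j : Fin (n + 1) ↦ w j) :=
    hl.linearIndependent hq hq1 hκ Fin.val_injective fun j ↦ hw0 j (by omega)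
  let ι : (Fin (n + 1) → ℂ) →ₗ[ℂ] Osc := Fintype.linearCombination ℂ (fun j : Fin (n + 1) ↦ w j)
  have hι : Function.Injective ι := hli.fintypeLinearCombination_injective
  let e := Pi.basisFun ℂ (Fin (n + 1))
  have hιe (j : Fin (n + 1)) : ι (e j) = w j := by simp [ι, e]
  have hmem (j : ℕ) : w j ∈ LinearMap.range ι := by
    rcases lt_or_ge n j with hj | hj
    · rw [hl.eq_zero_of_le (i := n + 1) hj hlast]; exact Submodule.zero_mem _
    · exact ⟨e ⟨j, by omega⟩, hιe _⟩
  have stable (f : Module.End ℂ Osc) (hf : ∀ j, f (w j) ∈ LinearMap.range ι)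
      (x : Fin (n + 1) → ℂ) : f (ι x) ∈ LinearMap.range ι := by
    simp only [ι, Fintype.linearCombination_apply, map_sum, map_smul]
    exact Submodule.sum_mem _ fun j _ ↦ Submodule.smul_mem _ _ (hf j)
  obtain ⟨τ, hτ⟩ := exists_restrict (c₁ := c₁) (c₂ := c₂) ρ ι hι
    (stable _ fun j ↦ by rw [hl.K_apply]; exact Submodule.smul_mem _ _ (hmem j))
    (stable _ fun j ↦ by
      rw [hl.K_inv_apply hq hκ hk'k]; exact Submodule.smul_mem _ _ (hmem j))
    (stable _ fun j ↦ by
      rcases j with _ | j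
      · rw [hl.B₁_zero]; exact Submodule.zero_mem _
      · rw [hB₁]; exact Submodule.smul_mem _ _ (hmem j))
    (stable _ fun j ↦ by rw [hl.B₂_apply]; exact hmem _)
  have hτK (j : Fin (n + 1)) : τ (B.K q c₁ c₂) (e j) = (q ^ (3 * (j : ℕ)) * κ) • e j := by
    apply hι
    rw [hτ, map_smul, hιe]
    exact hl.K_apply j
  have hτ₂ (j : Fin n) : τ (B.B₂ q c₁ c₂) (e j.castSucc) = e j.succ := by
    apply hι
    rw [hτ, hιe, hιe]
    exact hl.B₂_apply j
  have hτ₁ (j : Fin n) : τ (B.B₁ q c₁ c₂) (e j.succ) =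
      bCoeff q c₁ c₂ κ n ((j : ℕ) + 1) • e j.castSucc := by
    apply hι
    rw [hτ, map_smul, hιe, hιe]
    exact hB₁ j
  have hτ₀ : τ (B.B₁ q c₁ c₂) (e 0) = 0 := by
    apply hι
    rw [hτ, hιe, map_zero]
    exact hl.B₁_zero
  have hinj : Function.Injective fun j : Fin (n + 1) ↦ q ^ (3 * (j : ℕ)) * κ :=
    (IsLadder.weight_injective hq hq1 hκ).comp Fin.val_injective
  refine ⟨τ, e, isIrreducible_of_basis e hinj hτK hτ₂
    (fun j ↦ bCoeff_ne_zero hq hq1 hκ hc₁ hc₂ hκ' (j : ℕ).succ_pos j.2) hτ₁,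
    ⟨e.ne_zero 0, hτ₀, by simpa using hτK 0, fun hmem ↦ ?_⟩, hτK, hτ₂, ?_, hτ₀, hτ₁⟩
  -- Membership would give `q^{-3} = q^{3j}` with `j ≥ 0`.
  · obtain ⟨x, hx⟩ := (Module.End.hasEigenvalue_iff_mem_spectrum.2 hmem).exists_hasEigenvector
    obtain ⟨j, hj⟩ := exists_eq_of_basis_eigenvectors e hτK hx.2 hx.apply_eq_smul
    have h := congrArg norm (mul_right_cancel₀ hκ hj)
    rw [← zpow_natCast, norm_zpow, norm_zpow] at h
    have := (zpow_right_inj₀ (norm_pos_iff.2 hq) hq1.ne).1 h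
    push_cast at this
    omega
  · apply hι
    rw [hτ, hιe, map_zero]
    exact (hl.B₂_apply n).trans hlast

end QSP
end

theorem corollary3p4 (q : ℝ) (hq0 : 0 < q) (hq1 : q < 1)
    (c₁ c₂ : ℂ) (hc₁ : c₁ ≠ 0) (hc₂ : c₂ ≠ 0) :
    -- every finite-dimensional irreducible representation is a weight representation
    -- and has exactly one highest weight, which is nonzero
    (∀ (W : Type*) [AddCommGroup W] [Module ℂ W] [FiniteDimensional ℂ W]
        (τ : QSP.B (q : ℂ) c₁ c₂ →ₐ[ℂ] Module.End ℂ W), QSP.IsIrreducible τ →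
        QSP.IsWeightRep τ ∧
          ∃ κ : ℂ, κ ≠ 0 ∧ QSP.IsHighestWeight τ κ ∧
            ∀ κ' : ℂ, QSP.IsHighestWeight τ κ' → κ' = κ) ∧
    -- highest weight and dimension determine the representation up to isomorphism
    (∀ (W : Type*) [AddCommGroup W] [Module ℂ W] [FiniteDimensional ℂ W]
        (W' : Type*) [AddCommGroup W'] [Module ℂ W'] [FiniteDimensional ℂ W']
        (τ : QSP.B (q : ℂ) c₁ c₂ →ₐ[ℂ] Module.End ℂ W)
        (τ' : QSP.B (q : ℂ) c₁ c₂ →ₐ[ℂ] Module.End ℂ W')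
        (κ : ℂ) (n : ℕ), QSP.IsIrreducible τ → QSP.IsIrreducible τ' →
        QSP.IsHighestWeight τ κ → QSP.IsHighestWeight τ' κ →
        Module.finrank ℂ W = n + 1 → Module.finrank ℂ W' = n + 1 →
        Nonempty ((QSP.toRep τ).Equiv (QSP.toRep τ'))) ∧
    -- existence, with the explicit action on a basis `w_0, …, w_n`
    (∀ (κ : ℂ) (n : ℕ), κ ≠ 0 →
        (∀ m : ℕ, κ ^ 2 ≠ -c₁ * c₂⁻¹ * (q : ℂ) ^ (1 - (m : ℤ))) →
        ∃ (τ : QSP.B (q : ℂ) c₁ c₂ →ₐ[ℂ] Module.End ℂ (Fin (n + 1) → ℂ))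
          (w : Module.Basis (Fin (n + 1)) ℂ (Fin (n + 1) → ℂ)),
          QSP.IsIrreducible τ ∧
          QSP.IsHighestWeightVector τ κ (w 0) ∧
          (∀ j : Fin (n + 1), τ (QSP.B.K (q : ℂ) c₁ c₂) (w j) =
            ((q : ℂ) ^ (3 * (j : ℕ)) * κ) • w j) ∧
          (∀ j : Fin n, τ (QSP.B.B₂ (q : ℂ) c₁ c₂) (w j.castSucc) = w j.succ) ∧
          τ (QSP.B.B₂ (q : ℂ) c₁ c₂) (w (Fin.last n)) = 0 ∧
          τ (QSP.B.B₁ (q : ℂ) c₁ c₂) (w 0) = 0 ∧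
          (∀ j : Fin n, τ (QSP.B.B₁ (q : ℂ) c₁ c₂) (w j.succ) =
            QSP.bCoeff (q : ℂ) c₁ c₂ κ n ((j : ℕ) + 1) • w j.castSucc)) := by
  have hq : (q : ℂ) ≠ 0 := by exact_mod_cast hq0.ne'
  have hq' : ‖(q : ℂ)‖ < 1 := by rwa [Complex.norm_real, Real.norm_of_nonneg hq0.le]
  refine ⟨?_, ?_, ?_⟩
  · intro W _ _ _ τ hτ
    obtain ⟨κ, β, w, hκ, hw0, hspan, hw⟩ := hτ.exists_ladder hq hq'
    exact ⟨QSP.isWeightRep_of_isLadder hq hκ hw hspan, κ, hκ, ⟨w 0, hw0⟩, fun κ' hκ' ↦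
      hw.eq_of_isHighestWeight hq hq' hκ hw0.ne_zero hspan hκ'⟩
  · intro W _ _ _ W' _ _ _ τ τ' κ n hτ hτ' hκ hκ' hn hn'
    exact QSP.nonempty_equiv hq hq' hτ hτ' hκ hκ' (hn.trans hn'.symm)
  · intro κ n hκ hκ'
    exact QSP.exists_rep hq hq' hc₁ hc₂ hκ n hκ'
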